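/- Let $K$ be a number field, $\overline K$ an algebraic closure of $K$, $E/K$ an elliptic curve with origin $O$, and $\ell\ge 5$ a prime. Let $E[\ell]$ be the $\mathbb F_\ell$-vector space of points $P\in E(\overline K)$ with $\ell P=O$; for $R\in E[\ell]\setminus\{O\}$ let $K(R)$ be the field generated over $K$ by the coordinates of $R$, and let $K(E[\ell])$ be the field generated over $K$ by the coordinates of all the points of $E[\ell]\setminus\{O\}$. For an ordered basis $\mathcal B=\{P,Q\}$ of $E[\ell]$ and $\sigma\in\operatorname{Gal}(K(E[\ell])/K)$, let $\rho_{\mathcal B}(\sigma)=\begin{pmatrix}a&b\\c&d\end{pmatrix}\in\operatorname{GL}_2(\mathbb F_\ell)$ be the matrix with $P^\sigma=aP+bQ$ and $Q^\sigma=cP+dQ$, and let $G(\mathcal B)=\rho_{\mathcal B}(\operatorname{Gal}(K(E[\ell])/K))\subseteq\operatorname{GL}_2(\mathbb F_\ell)$. Fix a generator $\alpha$ of $\mathbb F_\ell^\times$. Let $\mathscr B\subseteq\operatorname{GL}_2(\mathbb F_\ell)$ be the Borel subgroup of invertible upper triangular matrices, let $\mathscr C_s\subseteq\operatorname{GL}_2(\mathbb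 F_\ell)$ be the split Cartan subgroup of invertible diagonal matrices, let $$\mathscr C_{ns}=\left\{\begin{pmatrix}a&b\alpha\\b&a\end{pmatrix}:(a,b)\in\mathbb F_\ell^2\setminus\{(0,0)\}\right\}$$ be the non-split Cartan subgroup, and let $\mathscr N_s$ and $\mathscr N_{ns}$ be the normalizers of $\mathscr C_s$ and of $\mathscr C_{ns}$ in $\operatorname{GL}_2(\mathbb F_\ell)$. Suppose that there exists $R\in E[\ell]\setminus\{O\}$ such that $2\nmid[K(R):K]$. Then there is a basis $\mathcal B$ of $E[\ell]$ such that $G(\mathcal B)$ is contained in $\mathscr B$, in $\mathscr N_s$, or in $\mathscr N_{ns}$. -/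

import Mathlib

noncomputable section

namespace EllipticTorsion

open WeierstrassCurve

/-! ### Subgroups of `GL₂` -/

section MatrixGroups

variable {R : Type*} [CommRing R]

/-- The Borel subgroup: the invertible upper triangular matrices. -/
def borelSubgroup (R : Type*) [CommRing R] : Subgroup (GL (Fin 2) R) where
  carrier := {A | A 1 0 = 0}
  one_mem' := by simp
  mul_mem' := by
    intro A B hA hB
    simp only [Set.mem_ofPred_eq] at hA hB ⊢
    simp [Matrix.mul_apply, Fin.sum_univ_two, hA, hB]
  inv_mem' := by
    intro A hA
    simp only [Set.mem_ofPred_eq] at hA ⊢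
    simp [Matrix.inv_def, Matrix.adjugate_fin_two, hA]

/-- The split Cartan subgroup: the invertible diagonal matrices. -/
def splitCartan (R : Type*) [CommRing R] : Subgroup (GL (Fin 2) R) where
  carrier := {A | A 0 1 = 0 ∧ A 1 0 = 0}
  one_mem' := by simp
  mul_mem' := by
    rintro A B ⟨hA, hA'⟩ ⟨hB, hB'⟩
    simp [Matrix.mul_apply, Fin.sum_univ_two, hA, hB, hA', hB']
  inv_mem' := by
    rintro A ⟨hA, hA'⟩
    simp [Matrix.inv_def, Matrix.adjugate_fin_two, hA, hA']

/-- The non-split Cartan subgroup attached to `α` (over a finite field of odd characteristic, with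
`α` a generator of the multiplicative group): the matrices `!![a, b * α; b, a]` in `GL₂`. -/
def nonsplitCartan (α : R) : Subgroup (GL (Fin 2) R) where
  carrier := {A | A 1 1 = A 0 0 ∧ A 0 1 = A 1 0 * α}
  one_mem' := by simp
  mul_mem' := by
    rintro A B ⟨hA, hA'⟩ ⟨hB, hB'⟩
    simp only [Set.mem_ofPred_eq, Units.val_mul, Matrix.mul_apply, Fin.sum_univ_two, hA, hB, hA',
      hB']
    constructor <;> ring
  inv_mem' := by
    rintro A ⟨hA, hA'⟩
    simp only [Set.mem_ofPred_eq, Matrix.coe_units_inv, Matrix.inv_def, Matrix.adjugate_fin_two,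
      Matrix.smul_apply, smul_eq_mul, Matrix.of_apply, Matrix.cons_val_zero, Matrix.cons_val_one,
      Matrix.cons_val', Matrix.cons_val_fin_one, hA, hA']
    constructor
    · trivial
    · ring

end MatrixGroups

/-! ### Torsion points and the fields they generate -/

section Torsion

variable {K : Type*} [Field K] (E : WeierstrassCurve K) (Ω : Type*) [Field Ω] [Algebra K Ω]

/-- The group `E(Ω)` of points of `E` over an extension `Ω` of `K`. -/
abbrev Pt : Type _ := (E.baseChange Ω).toAffine.Point

variable {E Ω}

/-- The set of coordinates of a point (empty for the point at infinity). -/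
def coords : Pt E Ω → Set Ω
  | .zero => ∅
  | .some x y _ => {x, y}

/-- The field `K(P)` generated over `K` by the coordinates of the point `P`. -/
def pointField (P : Pt E Ω) : IntermediateField K Ω :=
  IntermediateField.adjoin K (coords P)

variable (E Ω) [DecidableEq Ω]

/-- The subgroup `E[n]` of the points `P` in `E(Ω)` with `n • P = 0`. -/
abbrev torsion (n : ℕ) : AddSubgroup (Pt E Ω) := AddSubgroup.torsionBy (Pt E Ω) (n : ℤ)

instance torsionModule (n : ℕ) : Module (ZMod n) (torsion E Ω n) :=
  AddSubgroup.torsionBy.zmodModule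

/-- The field `K(E[n])` generated over `K` by the coordinates of the points of `E[n]`. -/
def torsionField (n : ℕ) : IntermediateField K Ω :=
  IntermediateField.adjoin K (⋃ P ∈ torsion E Ω n, coords P)

/-- The homomorphism `E[n](L) → E[n](M)` induced by a `K`-embedding `L → M`. -/
def torsionMap {L M : Type*} [Field L] [Field M] [Algebra K L] [Algebra K M] [DecidableEq L]
    [DecidableEq M] (f : L →ₐ[K] M) (n : ℕ) : torsion E L n →+ torsion E M n :=
  ((Affine.Point.map (W' := E.toAffine) f).comp (torsion E L n).subtype).codRestrict
    (torsion E M n) fun P => by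
      rw [AddSubgroup.torsionBy.nsmul_iff, ← map_nsmul, AddSubgroup.torsionBy.nsmul, map_zero]

@[simp]
lemma coe_torsionMap {L M : Type*} [Field L] [Field M] [Algebra K L] [Algebra K M] [DecidableEq L]
    [DecidableEq M] (f : L →ₐ[K] M) (n : ℕ) (P : torsion E L n) :
    (torsionMap E f n P : Pt E M) = Affine.Point.map (W' := E.toAffine) f P :=
  rfl

/-- All the points of `E[n]` are defined over `K(E[n])`. -/
lemma torsionMap_bijective (n : ℕ) :
    Function.Bijective (torsionMap E (torsionField E Ω n).val n) := by
  have hinj := Affine.Point.map_injective (W' := E.toAffine) (torsionField E Ω n).val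
  refine ⟨fun P Q h => Subtype.ext (hinj (congrArg Subtype.val h)), fun P => ?_⟩
  obtain ⟨Q, hQ⟩ :
      ∃ Q : Pt E (torsionField E Ω n), Affine.Point.map (torsionField E Ω n).val Q = P.1 := by
    obtain ⟨P, hP⟩ := P
    have hsub : coords P ⊆ torsionField E Ω n :=
      (Set.subset_biUnion_of_mem (u := coords) hP).trans (IntermediateField.subset_adjoin K _)
    cases P with
    | zero => exact ⟨0, rfl⟩
    | some x y h =>
      have hx : x ∈ torsionField E Ω n := hsub (by simp [coords])
      have hy : y ∈ torsionField E Ω n := hsub (by simp [coords])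
      exact ⟨.some ⟨x, hx⟩ ⟨y, hy⟩ ((E.toAffine.baseChange_nonsingular
        (f := (torsionField E Ω n).val) (RingHom.injective _) _ _).mp h), rfl⟩
  refine ⟨⟨Q, ?_⟩, Subtype.ext hQ⟩
  rw [AddSubgroup.torsionBy.nsmul_iff]
  apply hinj
  rw [map_nsmul, hQ, map_zero]
  exact AddSubgroup.torsionBy.nsmul_iff.mp P.2

/-- The identification of the `n`-torsion of `E(K(E[n]))` with `E[n]`. -/
def torsionEquiv (n : ℕ) : torsion E (torsionField E Ω n) n ≃+ torsion E Ω n :=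
  AddEquiv.ofBijective _ (torsionMap_bijective E Ω n)

/-- The action of `Gal(K(E[n])/K)` on `E[n]`, through coordinates. -/
def galAction (n : ℕ) : Gal(torsionField E Ω n/K) →* Module.End (ZMod n) (torsion E Ω n) where
  toFun σ := AddMonoidHom.toZModLinearMap n
    (((torsionEquiv E Ω n).toAddMonoidHom.comp (torsionMap E σ.toAlgHom n)).comp
      (torsionEquiv E Ω n).symm.toAddMonoidHom)
  map_one' := by
    ext1 P
    have h : torsionMap E (1 : Gal(torsionField E Ω n/K)).toAlgHom n = AddMonoidHom.id _ := by
      ext1 Q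
      exact Subtype.ext (Affine.Point.map_id Q.1)
    simp [h]
  map_mul' σ τ := by
    ext1 P
    have h : torsionMap E (σ * τ).toAlgHom n =
        (torsionMap E σ.toAlgHom n).comp (torsionMap E τ.toAlgHom n) := by
      ext1 Q
      exact Subtype.ext (Affine.Point.map_map τ.toAlgHom σ.toAlgHom Q.1).symm
    simp [h]

variable {E Ω}

/-- The homomorphism `ρ_B` attached to an ordered basis `B = (P, Q)` of `E[n]`: the rows of
`ρ_B(σ)` are the coordinates of `P ^ σ` and of `Q ^ σ` in the basis `B`. As `σ` acts on the right
here, the source is the opposite of the Galois group. -/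
def rho {n : ℕ} (B : Module.Basis (Fin 2) (ZMod n) (torsion E Ω n)) :
    (Gal(torsionField E Ω n/K))ᵐᵒᵖ →* GL (Fin 2) (ZMod n) :=
  MonoidHom.toHomUnits
    { toFun := fun σ => Matrix.of fun i j => B.repr (galAction E Ω n σ.unop (B i)) j
      map_one' := by
        ext i j
        simp [Matrix.one_apply, Finsupp.single_apply]
      map_mul' := fun σ τ => by
        have h : ∀ f : Module.End (ZMod n) (torsion E Ω n),
            (Matrix.of fun i j => B.repr (f (B i)) j) = (LinearMap.toMatrix B B f).transpose := by
          intro f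
          ext i j
          simp [LinearMap.toMatrix_apply]
        rw [h, h, h, ← Matrix.transpose_mul, ← LinearMap.toMatrix_mul, MulOpposite.unop_mul,
          map_mul] }

/-- The image `G(B)` of `ρ_B`. -/
def galImage {n : ℕ} (B : Module.Basis (Fin 2) (ZMod n) (torsion E Ω n)) :
    Subgroup (GL (Fin 2) (ZMod n)) :=
  (rho B).range

end Torsion

end EllipticTorsion

end

namespace EllipticTorsion

/-! ### Traceless two-by-two matrices. -/

section

open Matrix

section TwoByTwo

variable {F : Type*} [Field F]

/-! The hypothesis on `R` enters only through the claim that `-1` is not in the image `G` of Galois.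
An automorphism acting as `-1` fixes the `x`-coordinate of `R` and, as `ℓ` is odd, moves its
`y`-coordinate; then `y` is quadratic over `K(x)` and `K(R)` has even degree
(`two_dvd_finrank_pointField`).

The rest is group theory (`exists_conj_le`). Let `H` be the part of `G` of determinant one. By
Cayley–Hamilton no element of `H` has trace zero, and `H` has odd order. It follows that `G`
preserves, under conjugation, a line of traceless matrices (`exists_semiinvariant`). If `H` is
trivial, `G` is abelian. If `H` contains a unipotent `1 + N` with `N ≠ 0`, the line is that of `N`.
Otherwise `p` does not divide the order of `H`, and a computation with sums of traces replaces
character theory: if only scalars commuted with `H`, its order would vanish modulo `p`. A generator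
`T` of the line then decides the case: `-det T` is zero (Borel), a nonzero square (split) or a
nonsquare (non-split).

That `E[ℓ]` is a plane is proved by counting (`card_torsion`). Multiplication by `n` acts on
`x`-coordinates by a fraction `X / Z` with `Z` of degree `n ^ 2 - 1`. Since it multiplies the
invariant differential by `n`, for odd `n` every root of `Z` is exactly double, and each root
carries two opposite points. -/

lemma mul_self_fin_two (A : Matrix (Fin 2) (Fin 2) F) :
    A * A = A.trace • A - A.det • (1 : Matrix (Fin 2) (Fin 2) F) := by
  ext i j
  fin_cases i <;> fin_cases j <;>
    simp [Matrix.mul_apply, Fin.sum_univ_two, Matrix.trace_fin_two, Matrix.det_fin_two] <;> ring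

/-- Twice the traceless part of a `2 × 2` matrix. -/
def tracelessPart (A : Matrix (Fin 2) (Fin 2) F) : Matrix (Fin 2) (Fin 2) F :=
  (2 : F) • A - A.trace • (1 : Matrix (Fin 2) (Fin 2) F)

lemma trace_tracelessPart (A : Matrix (Fin 2) (Fin 2) F) : (tracelessPart A).trace = 0 := by
  simp [tracelessPart, Matrix.trace_fin_two]
  ring

lemma commute_tracelessPart {A B : Matrix (Fin 2) (Fin 2) F} (h : Commute A B) :
    Commute A (tracelessPart B) :=
  (h.smul_right _).sub_right ((Commute.one_right _).smul_right _)

/-- Two traceless matrices whose entries are proportional. -/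
lemma exists_eq_smul_of_minors {T S : Matrix (Fin 2) (Fin 2) F} (hT : T ≠ 0) (hT0 : T.trace = 0)
    (hS0 : S.trace = 0) (h1 : T 0 0 * S 0 1 = S 0 0 * T 0 1) (h2 : T 0 0 * S 1 0 = S 0 0 * T 1 0)
    (h3 : T 0 1 * S 1 0 = S 0 1 * T 1 0) : ∃ c : F, S = c • T := by
  rw [Matrix.trace_fin_two] at hT0 hS0
  have hT1 : T 1 1 = -T 0 0 := by linear_combination hT0
  have hS1 : S 1 1 = -S 0 0 := by linear_combination hS0
  by_cases ha : T 0 0 = 0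
  · by_cases hb : T 0 1 = 0
    · have hc : T 1 0 ≠ 0 := by
        intro hc
        apply hT
        ext i j
        fin_cases i <;> fin_cases j <;> simp [ha, hb, hc, hT1]
      refine ⟨S 1 0 / T 1 0, ?_⟩
      ext i j
      fin_cases i <;> fin_cases j <;> simp [hT1, hS1] <;> field_simp <;> grind
    · refine ⟨S 0 1 / T 0 1, ?_⟩
      ext i j
      fin_cases i <;> fin_cases j <;> simp [hT1, hS1] <;> field_simp <;> grind
  · refine ⟨S 0 0 / T 0 0, ?_⟩
    ext i j
    fin_cases i <;> fin_cases j <;> simp [hT1, hS1] <;> field_simp <;> grind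

/-- The commutator of two traceless matrices is their cross product: its entries are the minors of
the pair, two of them doubled. -/
lemma exists_eq_smul_of_commute {T S : Matrix (Fin 2) (Fin 2) F} (h2 : (2 : F) ≠ 0) (hT : T ≠ 0)
    (hT0 : T.trace = 0) (hS0 : S.trace = 0) (h : Commute S T) : ∃ c : F, S = c • T := by
  have e00 := congrFun (congrFun h.eq 0) 0
  have e01 := congrFun (congrFun h.eq 0) 1
  have e10 := congrFun (congrFun h.eq 1) 0
  have hT1 : T 1 1 = -T 0 0 := by rw [Matrix.trace_fin_two] at hT0; linear_combination hT0
  have hS1 : S 1 1 = -S 0 0 := by rw [Matrix.trace_fin_two] at hS0; linear_combination hS0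
  simp only [Matrix.mul_apply, Fin.sum_univ_two, hT1, hS1] at e00 e01 e10
  refine exists_eq_smul_of_minors hT hT0 hS0 ?_ ?_ ?_
  · apply mul_left_cancel₀ h2; linear_combination -e01
  · apply mul_left_cancel₀ h2; linear_combination e10
  · linear_combination -e00

/-- The squares of the minors lie in the ideal generated by the two determinants and the trace. In
odd characteristic this says that the determinant form on traceless matrices has no totally
isotropic plane. -/
lemma exists_eq_smul_of_nilpotent {T S : Matrix (Fin 2) (Fin 2) F} (hT : T ≠ 0)
    (hT0 : T.trace = 0) (hS0 : S.trace = 0) (hTd : T.det = 0) (hSd : S.det = 0)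
    (h : (T * S).trace = 0) : ∃ c : F, S = c • T := by
  have hT1 : T 1 1 = -T 0 0 := by rw [Matrix.trace_fin_two] at hT0; linear_combination hT0
  have hS1 : S 1 1 = -S 0 0 := by rw [Matrix.trace_fin_two] at hS0; linear_combination hS0
  simp only [Matrix.trace_fin_two, Matrix.det_fin_two, Matrix.mul_apply, Fin.sum_univ_two, hT1, hS1]
    at h hTd hSd
  refine exists_eq_smul_of_minors hT hT0 hS0 ?_ ?_ ?_ <;> rw [← sub_eq_zero] <;>
    apply pow_eq_zero_iff (two_ne_zero) |>.mp
  · linear_combination (-S 0 1 ^ 2) * hTd - T 0 1 ^ 2 * hSd - T 0 1 * S 0 1 * h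
  · linear_combination (-S 1 0 ^ 2) * hTd - T 1 0 ^ 2 * hSd - T 1 0 * S 1 0 * h
  · linear_combination (T 0 1 * S 1 0 + S 0 1 * T 1 0 - 2 * T 0 0 * S 0 0) * h
      - 4 * T 0 0 ^ 2 * hSd + 4 * (S 0 1 * S 1 0) * hTd

end TwoByTwo

end

/-! ### Subgroups of `GL₂(𝔽_p)` without `-1`: trivial special part and unipotents. -/

section

open Matrix

section GroupTheory

variable {p : ℕ} [Fact p.Prime] {G : Subgroup (GL (Fin 2) (ZMod p))}

lemma two_ne_zero_zmod (hp : p ≠ 2) : (2 : ZMod p) ≠ 0 := by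
  intro h
  have h' : ((2 : ℕ) : ZMod p) = 0 := by exact_mod_cast h
  rw [ZMod.natCast_eq_zero_iff] at h'
  exact hp ((Nat.prime_dvd_prime_iff_eq (Fact.out : p.Prime) Nat.prime_two).mp h')

/-- The elements of determinant one of a subgroup of `GL₂`. -/
def specialPart (G : Subgroup (GL (Fin 2) (ZMod p))) : Subgroup (GL (Fin 2) (ZMod p)) :=
  G ⊓ (Matrix.GeneralLinearGroup.det (n := Fin 2) (R := ZMod p)).ker

lemma mem_specialPart {g : GL (Fin 2) (ZMod p)} :
    g ∈ specialPart G ↔ g ∈ G ∧ (g : Matrix (Fin 2) (Fin 2) (ZMod p)).det = 1 := by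
  simp [specialPart, Subgroup.mem_inf, MonoidHom.mem_ker, Units.ext_iff]

lemma conj_mem_specialPart {g h : GL (Fin 2) (ZMod p)} (hg : g ∈ specialPart G) (hh : h ∈ G) :
    h * g * h⁻¹ ∈ specialPart G := by
  refine ⟨G.mul_mem (G.mul_mem hh hg.1) (G.inv_mem hh), ?_⟩
  exact (MonoidHom.normal_ker _).conj_mem _ hg.2 _

/-- An element of determinant one with trace zero has square `-1`. -/
lemma trace_ne_zero (hG : -1 ∉ G) {g : GL (Fin 2) (ZMod p)} (hg : g ∈ specialPart G) :
    (g : Matrix (Fin 2) (Fin 2) (ZMod p)).trace ≠ 0 := by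
  intro h
  rw [mem_specialPart] at hg
  apply hG
  have : g * g = -1 := by
    ext1
    rw [Units.val_mul, mul_self_fin_two, h, hg.2]
    simp
  rw [← this]
  exact G.mul_mem hg.1 hg.1

lemma eq_one_of_eq_smul_one (hG : -1 ∉ G) {g : GL (Fin 2) (ZMod p)}
    (hg : g ∈ specialPart G) {c : ZMod p}
    (h : (g : Matrix (Fin 2) (Fin 2) (ZMod p)) = c • (1 : Matrix (Fin 2) (Fin 2) (ZMod p))) :
    g = 1 := by
  have hd := (mem_specialPart.mp hg).2
  rw [h] at hd
  simp only [Matrix.det_smul, Fintype.card_fin, Matrix.det_one, mul_one, sq_eq_one_iff] at hd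
  rcases hd with rfl | rfl
  · ext1; simpa using h
  · refine absurd hg.1 ?_
    have : g = -1 := by ext1; simpa using h
    rwa [this]

lemma eq_one_of_tracelessPart (hp : p ≠ 2) (hG : -1 ∉ G) {g : GL (Fin 2) (ZMod p)}
    (hg : g ∈ specialPart G) (h : tracelessPart (g : Matrix (Fin 2) (Fin 2) (ZMod p)) = 0) :
    g = 1 := by
  have h2 := two_ne_zero_zmod hp
  refine eq_one_of_eq_smul_one hG hg
    (c := 2⁻¹ * (g : Matrix (Fin 2) (Fin 2) (ZMod p)).trace) ?_
  rw [tracelessPart, sub_eq_zero] at h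
  rw [mul_smul, ← h, smul_smul, inv_mul_cancel₀ h2, one_smul]

/-- An element `g` of order two satisfies `tr(g) g = 2` by Cayley–Hamilton. The trace is not zero,
so `g` is scalar, hence `1`. -/
lemma odd_card_specialPart (hG : -1 ∉ G) :
    (Nat.card (specialPart G)).Coprime 2 := by
  rw [Nat.coprime_comm, Nat.Prime.coprime_iff_not_dvd Nat.prime_two]
  intro hd
  have : Fact (Nat.Prime 2) := ⟨Nat.prime_two⟩
  obtain ⟨g, hg⟩ := exists_prime_orderOf_dvd_card' 2 hd
  have hg1 : g ≠ 1 := by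
    rintro rfl
    simp at hg
  apply hg1
  have hsq : (g : GL (Fin 2) (ZMod p)) * g = 1 := by
    have := pow_orderOf_eq_one g
    rw [hg, pow_two] at this
    exact_mod_cast congrArg Subtype.val this
  have ht := trace_ne_zero hG g.2
  have hm := mul_self_fin_two ((g : GL (Fin 2) (ZMod p)) : Matrix (Fin 2) (Fin 2) (ZMod p))
  rw [← Units.val_mul, hsq, (mem_specialPart.mp g.2).2, Units.val_one] at hm
  apply Subtype.ext
  refine eq_one_of_eq_smul_one hG g.2
    (c := ((g : GL (Fin 2) (ZMod p)) : Matrix (Fin 2) (Fin 2) (ZMod p)).trace⁻¹ * 2) ?_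
  rw [mul_smul, two_smul, eq_inv_smul_iff₀ ht]
  rw [one_smul] at hm
  nth_rewrite 1 [hm]
  abel_nf

lemma mul_eq_smul_of_conj {h : GL (Fin 2) (ZMod p)} {T : Matrix (Fin 2) (Fin 2) (ZMod p)}
    {c : ZMod p} (hc : h.1 * T * h⁻¹.1 = c • T) : h.1 * T = c • (T * h.1) := by
  rw [← smul_mul_assoc, ← hc, mul_assoc, ← Units.val_mul, inv_mul_cancel, Units.val_one, mul_one]

lemma trace_conj (h : GL (Fin 2) (ZMod p)) (T : Matrix (Fin 2) (Fin 2) (ZMod p)) :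
    (h.1 * T * h⁻¹.1).trace = T.trace := by
  rw [Matrix.trace_mul_comm, ← mul_assoc, ← Units.val_mul, inv_mul_cancel, Units.val_one, one_mul]

lemma det_conj (h : GL (Fin 2) (ZMod p)) (T : Matrix (Fin 2) (Fin 2) (ZMod p)) :
    (h.1 * T * h⁻¹.1).det = T.det := by
  rw [Matrix.det_mul_comm, ← mul_assoc, ← Units.val_mul, inv_mul_cancel, Units.val_one, one_mul]

/-- Commutators have determinant one, so `G` is abelian and commutes with the traceless part of any
of its non-scalar elements. If all elements are scalar, any `T` serves. -/
lemma exists_semiinvariant_of_specialPart_trivial (hp : p ≠ 2)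
    (h1 : ∀ g ∈ specialPart G, g = 1) :
    ∃ T : Matrix (Fin 2) (Fin 2) (ZMod p), T ≠ 0 ∧ T.trace = 0 ∧
      ∀ g ∈ G, ∃ c : ZMod p, g.1 * T = c • (T * g.1) := by
  by_cases hs : ∀ g ∈ G, tracelessPart g.1 = 0
  · refine ⟨!![1, 0; 0, -1], fun h => ?_, by simp [Matrix.trace_fin_two], fun g hg => ⟨1, ?_⟩⟩
    · simpa using congrFun (congrFun h 0) 0
    · have h2 := two_ne_zero_zmod hp
      have := hs g hg
      rw [tracelessPart, sub_eq_zero] at this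
      have hg' : g.1 = (2⁻¹ * g.1.trace) • (1 : Matrix (Fin 2) (Fin 2) (ZMod p)) := by
        rw [mul_smul, ← this, smul_smul, inv_mul_cancel₀ h2, one_smul]
      rw [hg']
      simp
  · push Not at hs
    obtain ⟨g, hg, hT⟩ := hs
    refine ⟨_, hT, trace_tracelessPart _, fun h hh => ⟨1, ?_⟩⟩
    rw [one_smul]
    refine (commute_tracelessPart ?_).eq
    have : h * g * h⁻¹ * g⁻¹ = 1 := by
      apply h1
      refine ⟨G.mul_mem (G.mul_mem (G.mul_mem hh hg) (G.inv_mem hh)) (G.inv_mem hg), ?_⟩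
      change Matrix.GeneralLinearGroup.det _ = 1
      simp only [map_mul, map_inv]
      rw [mul_right_comm _ _ (_ : (ZMod p)ˣ)⁻¹]
      simp
    rw [mul_inv_eq_one, mul_inv_eq_iff_eq_mul] at this
    exact congrArg Units.val this

lemma pow_one_add_of_mul_self {N : Matrix (Fin 2) (Fin 2) (ZMod p)} (hN : N * N = 0) (k : ℕ) :
    (1 + N) ^ k = 1 + (k : ZMod p) • N := by
  induction k with
  | zero => simp
  | succ k ih =>
    rw [pow_succ, ih, add_mul, one_mul, mul_add, mul_one, smul_mul_assoc, hN]
    push_cast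
    rw [add_smul, one_smul, smul_zero]
    abel

/-- A nontrivial unipotent element spans a line stable under conjugation. -/
lemma exists_semiinvariant_of_unipotent (hG : -1 ∉ G) {g : GL (Fin 2) (ZMod p)}
    (hg : g ∈ specialPart G) (hg1 : g ≠ 1) (ht : g.1.trace = 2) :
    ∃ T : Matrix (Fin 2) (Fin 2) (ZMod p), T ≠ 0 ∧ T.trace = 0 ∧
      ∀ g ∈ G, ∃ c : ZMod p, g.1 * T = c • (T * g.1) := by
  obtain ⟨N, hN⟩ : ∃ N, N = g.1 - 1 := ⟨_, rfl⟩
  have hgN : g.1 = 1 + N := by rw [hN]; abel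
  have hN0 : N ≠ 0 := by
    rintro rfl
    apply hg1
    ext1
    simpa using hgN
  have hNt : N.trace = 0 := by
    rw [hN, Matrix.trace_sub, ht, Matrix.trace_one]
    simp
  have hNd : N.det = 0 := by
    have hd := (mem_specialPart.mp hg).2
    rw [hN]
    rw [Matrix.trace_fin_two] at ht
    rw [Matrix.det_fin_two] at hd ⊢
    simp
    linear_combination hd - ht
  refine ⟨N, hN0, hNt, fun h hh => ?_⟩
  have hSt := trace_conj h N
  have hSd := det_conj h N
  obtain ⟨S, hS⟩ : ∃ S, S = h.1 * N * h⁻¹.1 := ⟨_, rfl⟩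
  rw [← hS, hNt] at hSt
  rw [← hS, hNd] at hSd
  have hS2 : S * S = 0 := by rw [mul_self_fin_two, hSt, hSd]; simp
  have hconj : (h * g * h⁻¹).1 = 1 + S := by
    rw [Units.val_mul, Units.val_mul, hgN, mul_add, add_mul, ← hS, mul_one, ← Units.val_mul]
    simp
  have hprop : ∃ c : ZMod p, S = c • N := by
    apply exists_eq_smul_of_nilpotent hN0 hNt hSt hNd hSd
    by_contra hne
    -- The trace of `g * (h * g * h⁻¹) ^ k` is `2 + k * tr(N * S)`; this `k` would make it zero.
    obtain ⟨k, hk⟩ : ∃ k : ℕ, (k : ZMod p) = -2 / (N * S).trace :=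
      ⟨_, ZMod.natCast_zmod_val _⟩
    refine trace_ne_zero hG
      ((specialPart G).mul_mem hg ((specialPart G).pow_mem (conj_mem_specialPart hg hh) k)) ?_
    rw [Units.val_mul, Units.val_pow_eq_pow_val, hconj, pow_one_add_of_mul_self hS2, hgN, hk]
    simp only [add_mul, mul_add, one_mul, mul_one, Matrix.trace_add, mul_smul_comm,
      Matrix.trace_smul, hSt, hNt, Matrix.trace_one, Fintype.card_fin, smul_eq_mul]
    field_simp
    norm_num
  obtain ⟨c, hc⟩ := hprop
  exact ⟨c, mul_eq_smul_of_conj (hS.symm.trans hc)⟩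

/-- An element of order `p` satisfies `(g - 1) ^ p = g ^ p - 1 = 0`, so it is unipotent and has
trace `2`. -/
lemma not_dvd_card_specialPart (h1 : ∀ g ∈ specialPart G, g.1.trace = 2 → g = 1) :
    ¬ p ∣ Nat.card (specialPart G) := by
  intro hd
  obtain ⟨g, hg⟩ := exists_prime_orderOf_dvd_card' p hd
  have hg1 : g ≠ 1 := by
    rintro rfl
    rw [orderOf_one] at hg
    exact (Fact.out : p.Prime).one_lt.ne hg
  apply hg1
  apply Subtype.ext
  apply h1 _ g.2
  have hpow : (g : GL (Fin 2) (ZMod p)).1 ^ p = 1 := by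
    have := pow_orderOf_eq_one g
    rw [hg] at this
    exact congrArg (fun x => (Subtype.val x : GL (Fin 2) (ZMod p)).1) this
  have hnil : IsNilpotent ((g : GL (Fin 2) (ZMod p)).1 - 1) := by
    refine ⟨p, ?_⟩
    rw [sub_pow_char_of_commute _ (Commute.one_right _), hpow, one_pow, sub_self]
  have := (Matrix.isNilpotent_trace_of_isNilpotent hnil).eq_zero
  rw [Matrix.trace_sub, Matrix.trace_one, sub_eq_zero] at this
  rw [this]
  simp

end GroupTheory

end

/-! ### Sums of traces and the invariant line. -/

section

open Matrix

section GroupTheory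

variable {p : ℕ} [Fact p.Prime] {G : Subgroup (GL (Fin 2) (ZMod p))}

/-- If only the scalars commute with a group of matrices of determinant one, then the squares of
the traces add up to the order of the group. -/
lemma sum_trace_mul_trace (hp : p ≠ 2) (H : Subgroup (GL (Fin 2) (ZMod p))) [Fintype H]
    (hdet : ∀ g ∈ H, g.1.det = 1)
    (hsc : ∀ X : Matrix (Fin 2) (Fin 2) (ZMod p), (∀ g ∈ H, Commute g.1 X) →
      tracelessPart X = 0) :
    ∑ g : H, g.1.1.trace * g.1.1.trace = Fintype.card H := by
  have h2 := two_ne_zero_zmod hp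
  have key : ∀ i j : Fin 2, 2 * ∑ g : H, (g.1.1 i i * (g⁻¹).1.1 j j) =
      if i = j then (Fintype.card H : ZMod p) else 0 := by
    intro i j
    -- Schur's argument: the sum of the conjugates of a matrix unit commutes with `H`, so `2 * M` is
    -- the scalar `tr M`. The claim is its `(i, j)` entry.
    obtain ⟨M, hM⟩ : ∃ M, M = ∑ g : H, g.1.1 * Matrix.single i j (1 : ZMod p) * (g⁻¹).1.1 :=
      ⟨_, rfl⟩
    have hc : ∀ g ∈ H, Commute g.1 M := by
      intro g hg
      have : M = g.1 * M * g⁻¹.1 := by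
        conv_lhs => rw [hM, ← Equiv.sum_comp (Equiv.mulLeft (⟨g, hg⟩ : H))]
        rw [hM, Finset.mul_sum, Finset.sum_mul]
        refine Finset.sum_congr rfl fun x _ => ?_
        simp [mul_assoc]
      rw [commute_iff_eq]
      nth_rewrite 2 [this]
      rw [mul_assoc _ _ g.1, ← Units.val_mul]
      simp
    have hs := hsc M hc
    have ht : M.trace = if i = j then (Fintype.card H : ZMod p) else 0 := by
      rw [hM, Matrix.trace_sum]
      have : ∀ g : H, (g.1.1 * Matrix.single i j (1 : ZMod p) * (g⁻¹).1.1).trace =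
          (Matrix.single i j (1 : ZMod p)).trace := fun g => trace_conj g.1 _
      simp only [this]
      split_ifs with hij
      · subst hij; simp [Matrix.trace_single_eq_same]
      · simp [Matrix.trace_single_eq_of_ne _ _ _ hij]
    have he := congrFun (congrFun hs i) j
    rw [tracelessPart, ht, hM] at he
    simp only [Matrix.sub_apply, Matrix.smul_apply, Matrix.sum_apply, smul_eq_mul,
      Matrix.zero_apply, Matrix.one_apply] at he
    have hent : ∀ g : H, (g.1.1 * Matrix.single i j (1 : ZMod p) * (g⁻¹).1.1) i j =
        g.1.1 i i * (g⁻¹).1.1 j j := by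
      intro g
      fin_cases i <;> fin_cases j <;>
        simp [Matrix.mul_apply, Fin.sum_univ_two, Matrix.single_apply]
    simp only [hent] at he
    rw [sub_eq_zero] at he
    rw [he]
    split_ifs <;> simp
  -- In determinant one `g` and `g⁻¹` have the same trace, so the square is `tr(g) * tr(g⁻¹)`.
  have htr : ∀ g : H, g.1.1.trace * g.1.1.trace = g.1.1 0 0 * (g⁻¹).1.1 0 0 +
      g.1.1 0 0 * (g⁻¹).1.1 1 1 + g.1.1 1 1 * (g⁻¹).1.1 0 0 + g.1.1 1 1 * (g⁻¹).1.1 1 1 := by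
    intro g
    have : (g⁻¹).1.1 = !![g.1.1 1 1, -g.1.1 0 1; -g.1.1 1 0, g.1.1 0 0] := by
      rw [Subgroup.coe_inv, Matrix.coe_units_inv, Matrix.inv_def, hdet _ g.2,
        Matrix.adjugate_fin_two]
      simp
    rw [this, Matrix.trace_fin_two]
    simp
    ring
  apply mul_left_cancel₀ h2
  simp only [htr, Finset.sum_add_distrib, mul_add, key]
  simp
  ring

/-- A group of odd order of matrices of determinant one without unipotent elements is abelian:
it is trivial or commutes with some matrix that is not scalar. -/
lemma exists_commute_specialPart (hp : p ≠ 2) (hG : -1 ∉ G)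
    (h1 : ∀ g ∈ specialPart G, g.1.trace = 2 → g = 1) {g₀ : GL (Fin 2) (ZMod p)}
    (hg₀ : g₀ ∈ specialPart G) (hne : g₀ ≠ 1) :
    ∃ X : Matrix (Fin 2) (Fin 2) (ZMod p), tracelessPart X ≠ 0 ∧
      ∀ g ∈ specialPart G, Commute g.1 X := by
  by_contra hcon
  push Not at hcon
  have := Fintype.ofFinite (specialPart G)
  have hsum := sum_trace_mul_trace hp (specialPart G) (fun g hg => (mem_specialPart.mp hg).2)
    (fun X hX => by
      by_contra h
      obtain ⟨g, hg, hg'⟩ := hcon X h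
      exact hg' (hX g hg))
  have hcard : (Fintype.card (specialPart G) : ZMod p) ≠ 0 := by
    rw [← Nat.card_eq_fintype_card, Ne, ZMod.natCast_eq_zero_iff]
    exact not_dvd_card_specialPart h1
  -- Multiplication by `g₀` fixes the sum, and `det(g₀ - 1) = 2 - tr(g₀)` is not zero.
  have hA : ∑ g : specialPart G, g.1.1 = 0 := by
    have hfix : g₀.1 * ∑ g : specialPart G, g.1.1 = ∑ g : specialPart G, g.1.1 := by
      conv_rhs => rw [← Equiv.sum_comp (Equiv.mulLeft (⟨g₀, hg₀⟩ : specialPart G))]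
      rw [Finset.mul_sum]
      simp
    have hdet : IsUnit (g₀.1 - 1) := by
      rw [Matrix.isUnit_iff_isUnit_det, isUnit_iff_ne_zero]
      intro h
      apply hne
      apply h1 _ hg₀
      have hd := (mem_specialPart.mp hg₀).2
      rw [Matrix.det_fin_two] at h hd
      simp at h
      rw [Matrix.trace_fin_two]
      linear_combination hd - h
    apply hdet.mul_left_cancel
    rw [sub_mul, hfix, one_mul, sub_self, mul_zero]
  have htr : ∑ g : specialPart G, g.1.1.trace = 0 := by
    rw [← Matrix.trace_sum, hA, Matrix.trace_zero]
  -- Squaring permutes a group of odd order. With `tr(g ^ 2) = tr(g) ^ 2 - 2` this gives `0 = |H| -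
  -- 2 * |H|` in `𝔽_p`.
  have hsq : ∑ g : specialPart G, (g ^ 2).1.1.trace = 0 := by
    rw [← htr]
    exact Equiv.sum_comp (powCoprime (odd_card_specialPart hG))
      (fun g : specialPart G => g.1.1.trace)
  have hsq' : ∀ g : specialPart G, (g ^ 2).1.1.trace = g.1.1.trace * g.1.1.trace - 2 := by
    intro g
    rw [Subgroup.coe_pow, Units.val_pow_eq_pow_val, pow_two, mul_self_fin_two,
      (mem_specialPart.mp g.2).2]
    simp
  simp only [hsq', Finset.sum_sub_distrib, hsum] at hsq
  apply hcard
  simp at hsq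
  linear_combination -hsq

/-- A subgroup of `GL₂(𝔽_p)` without `-1` normalizes the line spanned by a traceless matrix. -/
lemma exists_semiinvariant (hp : p ≠ 2) (hG : -1 ∉ G) :
    ∃ T : Matrix (Fin 2) (Fin 2) (ZMod p), T ≠ 0 ∧ T.trace = 0 ∧
      ∀ g ∈ G, ∃ c : ZMod p, g.1 * T = c • (T * g.1) := by
  by_cases hone : ∀ g ∈ specialPart G, g = 1
  · exact exists_semiinvariant_of_specialPart_trivial hp hone
  by_cases huni : ∀ g ∈ specialPart G, g.1.trace = 2 → g = 1
  · push Not at hone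
    obtain ⟨g, hg, hne⟩ := hone
    obtain ⟨X, hX, hXc⟩ := exists_commute_specialPart hp hG huni hg hne
    have h2 := two_ne_zero_zmod hp
    -- All traceless parts of elements of `H` lie on the line of that of `X`, and a nontrivial `g`
    -- gives a nonzero one. Conjugation by `G` preserves `H`, hence this line.
    have hprop : ∀ g' ∈ specialPart G, ∃ c : ZMod p,
        tracelessPart g'.1 = c • tracelessPart X := fun g' hg' =>
      exists_eq_smul_of_commute h2 hX (trace_tracelessPart _) (trace_tracelessPart _)
        (commute_tracelessPart (commute_tracelessPart (hXc _ hg').symm).symm).symm.symm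
    refine ⟨_, hX, trace_tracelessPart X, fun h hh => ?_⟩
    obtain ⟨c, hc⟩ := hprop g hg
    obtain ⟨d, hd⟩ := hprop _ (conj_mem_specialPart hg hh)
    have hc0 : c ≠ 0 := by
      rintro rfl
      rw [zero_smul] at hc
      exact hne (eq_one_of_tracelessPart hp hG hg hc)
    refine ⟨c⁻¹ * d, mul_eq_smul_of_conj ?_⟩
    have hcj : tracelessPart (h * g * h⁻¹).1 = h.1 * tracelessPart g.1 * h⁻¹.1 := by
      rw [tracelessPart, tracelessPart, Units.val_mul, Units.val_mul, trace_conj, mul_sub, sub_mul]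
      simp
    rw [hd, hc] at hcj
    rw [mul_smul, hcj]
    simp [smul_smul, inv_mul_cancel₀ hc0]
  · push Not at huni
    obtain ⟨g, hg, ht, hne⟩ := huni
    exact exists_semiinvariant_of_unipotent hG hg hne ht

end GroupTheory

end

/-! ### Normal forms of the invariant line and the three subgroups. -/

section

open Matrix

section Conjugation

variable {p : ℕ} [Fact p.Prime] {G : Subgroup (GL (Fin 2) (ZMod p))}

/-- A matrix that commutes or anticommutes with `J` normalizes the centralizer of `J`. -/
lemma mem_normalizer_of_sign {C : Subgroup (GL (Fin 2) (ZMod p))}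
    {J : Matrix (Fin 2) (Fin 2) (ZMod p)} (hC : ∀ g, g ∈ C ↔ Commute g.1 J)
    {g : GL (Fin 2) (ZMod p)} (hg : g.1 * J = J * g.1 ∨ g.1 * J = -(J * g.1)) :
    g ∈ Subgroup.normalizer (C : Set (GL (Fin 2) (ZMod p))) := by
  obtain ⟨e, he, h⟩ : ∃ e : ZMod p, e * e = 1 ∧ g.1 * J = e • (J * g.1) := by
    rcases hg with hg | hg
    · exact ⟨1, by simp, by simpa using hg⟩
    · exact ⟨-1, by simp, by simpa using hg⟩
  have hinv : g⁻¹.1 * J = e • (J * g⁻¹.1) := by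
    have h1 : g⁻¹.1 * (g.1 * J) * g⁻¹.1 = g⁻¹.1 * (e • (J * g.1)) * g⁻¹.1 := by rw [h]
    rw [← mul_assoc, ← Units.val_mul, inv_mul_cancel, Units.val_one, one_mul, mul_smul_comm,
      smul_mul_assoc, mul_assoc _ _ g⁻¹.1, mul_assoc J, ← Units.val_mul, mul_inv_cancel,
      Units.val_one, mul_one] at h1
    rw [h1, smul_smul, he, one_smul]
  have hstep : ∀ u : GL (Fin 2) (ZMod p), u.1 * J = e • (J * u.1) →
      u⁻¹.1 * J = e • (J * u⁻¹.1) → ∀ n ∈ C, u * n * u⁻¹ ∈ C := by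
    intro u hu hu' n hn
    rw [hC] at hn ⊢
    rw [commute_iff_eq] at hn ⊢
    rw [Units.val_mul, Units.val_mul, mul_assoc, hu', mul_smul_comm, mul_assoc, ← mul_assoc n.1,
      hn, ← mul_assoc, ← mul_assoc, hu, smul_mul_assoc, smul_mul_assoc, smul_smul, he, one_smul]
    simp only [mul_assoc]
  rw [Subgroup.mem_normalizer_iff]
  refine fun n => ⟨hstep g h hinv n, fun hn => ?_⟩
  have := hstep g⁻¹ hinv (by rw [inv_inv]; exact h) _ hn
  simpa [mul_assoc] using this

/-- Each Cartan subgroup is the centralizer of a traceless `J`, the form required by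
`mem_normalizer_of_sign`. -/
lemma mem_splitCartan_iff (hp : p ≠ 2) {s : ZMod p} (hs : s ≠ 0) (g : GL (Fin 2) (ZMod p)) :
    g ∈ splitCartan (ZMod p) ↔ Commute g.1 !![s, 0; 0, -s] := by
  have h2 := two_ne_zero_zmod hp
  change (g.1 0 1 = 0 ∧ g.1 1 0 = 0) ↔ _
  rw [commute_iff_eq]
  constructor
  · rintro ⟨h01, h10⟩
    ext i j
    fin_cases i <;> fin_cases j <;> simp [Matrix.mul_apply, Fin.sum_univ_two, h01, h10, mul_comm]
  · intro h
    have e01 := congrFun (congrFun h 0) 1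
    have e10 := congrFun (congrFun h 1) 0
    simp [Matrix.mul_apply, Fin.sum_univ_two] at e01 e10
    constructor
    · apply mul_left_cancel₀ (mul_ne_zero h2 hs); linear_combination -e01
    · apply mul_left_cancel₀ (mul_ne_zero h2 hs); linear_combination e10

lemma mem_nonsplitCartan_iff {a : ZMod p} (g : GL (Fin 2) (ZMod p)) :
    g ∈ nonsplitCartan a ↔ Commute g.1 !![0, a; 1, 0] := by
  change (g.1 1 1 = g.1 0 0 ∧ g.1 0 1 = g.1 1 0 * a) ↔ _
  rw [commute_iff_eq]
  constructor
  · rintro ⟨h11, h01⟩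
    ext i j
    fin_cases i <;> fin_cases j <;> simp [Matrix.mul_apply, Fin.sum_univ_two, h01, h11, mul_comm]
  · intro h
    have e00 := congrFun (congrFun h 0) 0
    have e01 := congrFun (congrFun h 0) 1
    have e10 := congrFun (congrFun h 1) 0
    simp [Matrix.mul_apply, Fin.sum_univ_two] at e00 e01 e10
    exact ⟨e10, by rw [e00, mul_comm]⟩

/-- Transport of the commutation relations to a conjugate. -/
lemma conj_mul_eq_smul {P g : GL (Fin 2) (ZMod p)} {T J : Matrix (Fin 2) (Fin 2) (ZMod p)}
    {c : ZMod p} (hPJ : P.1 * T = J * P.1) (h : g.1 * T = c • (T * g.1)) :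
    (P * g * P⁻¹).1 * J = c • (J * (P * g * P⁻¹).1) := by
  have hJ : P⁻¹.1 * J = T * P⁻¹.1 := by
    have h1 : P⁻¹.1 * (P.1 * T) * P⁻¹.1 = P⁻¹.1 * (J * P.1) * P⁻¹.1 := by rw [hPJ]
    rw [← mul_assoc, ← Units.val_mul, inv_mul_cancel, Units.val_one, one_mul, mul_assoc,
      mul_assoc J, ← Units.val_mul, mul_inv_cancel, Units.val_one, mul_one] at h1
    exact h1.symm
  rw [Units.val_mul, Units.val_mul, mul_assoc, hJ, mul_assoc, ← mul_assoc g.1, h, ← mul_assoc J,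
    ← mul_assoc J, ← hPJ]
  simp [mul_assoc]

lemma sq_eq_one_of_mul_eq_smul {g : GL (Fin 2) (ZMod p)} {T : Matrix (Fin 2) (Fin 2) (ZMod p)}
    {c : ZMod p} (hT : T.det ≠ 0) (h : g.1 * T = c • (T * g.1)) : c = 1 ∨ c = -1 := by
  have hd := congrArg Matrix.det h
  rw [Matrix.det_smul, Matrix.det_mul, Matrix.det_mul, Fintype.card_fin] at hd
  have hg : g.1.det ≠ 0 := (Matrix.isUnit_iff_isUnit_det _ |>.mp g.isUnit).ne_zero
  rw [← sq_eq_one_iff]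
  apply mul_right_cancel₀ (mul_ne_zero hT hg)
  linear_combination -hd

lemma exists_row_ne_zero {A : Matrix (Fin 2) (Fin 2) (ZMod p)} (hA : A ≠ 0) : ∃ i, A i ≠ 0 := by
  by_contra! h
  exact hA (funext h)

/-- Since `T * g` is proportional to `g * T`, the row space of `T`, a line, is stable under right
multiplication by `G`. It is spanned by the second row of `P`; `v` completes a basis. -/
lemma exists_conj_le_borel {T : Matrix (Fin 2) (Fin 2) (ZMod p)} (hT : T ≠ 0) (ht : T.trace = 0)
    (hd : T.det = 0) (hG : ∀ g ∈ G, ∃ c : ZMod p, g.1 * T = c • (T * g.1)) :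
    ∃ P : GL (Fin 2) (ZMod p), ∀ g ∈ G, P * g * P⁻¹ ∈ borelSubgroup (ZMod p) := by
  have hT1 : T 1 1 = -T 0 0 := by rw [Matrix.trace_fin_two] at ht; linear_combination ht
  rw [Matrix.det_fin_two, hT1] at hd
  obtain ⟨i, hi⟩ := exists_row_ne_zero hT
  obtain ⟨v, hv⟩ : ∃ v : Fin 2 → ZMod p, v 0 * T i 1 - v 1 * T i 0 ≠ 0 := by
    by_contra! h
    have h0 := h ![1, 0]
    have h1 := h ![0, 1]
    simp at h0 h1
    apply hi
    ext j
    fin_cases j <;> simp [h0, h1]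
  refine ⟨Matrix.GeneralLinearGroup.mkOfDetNeZero !![v 0, v 1; T i 0, T i 1]
    (by rw [Matrix.det_fin_two_of]; exact hv), fun g hg => ?_⟩
  obtain ⟨c, hc⟩ := hG g hg
  have hc0 : c ≠ 0 := by
    rintro rfl
    rw [zero_smul] at hc
    exact hT (g.isUnit.mul_left_cancel (hc.trans (mul_zero _).symm))
  have e0 := congrFun (congrFun hc 0) 0
  have e1 := congrFun (congrFun hc 0) 1
  have e2 := congrFun (congrFun hc 1) 0
  have e3 := congrFun (congrFun hc 1) 1
  simp only [Matrix.mul_apply, Fin.sum_univ_two, Matrix.smul_apply, smul_eq_mul, hT1] at e0 e1 e2 e3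
  change (_ : GL (Fin 2) (ZMod p)).1 1 0 = 0
  have key : (T i 0 * g.1 0 0 + T i 1 * g.1 1 0) * T i 1 -
      (T i 0 * g.1 0 1 + T i 1 * g.1 1 1) * T i 0 = 0 := by
    apply mul_left_cancel₀ hc0
    fin_cases i <;> simp [hT1] <;> grind
  simp only [Units.val_mul, Matrix.coe_units_inv, Matrix.inv_def,
    Matrix.GeneralLinearGroup.mkOfDetNeZero, Matrix.adjugate_fin_two]
  simp [Matrix.mul_apply, Fin.sum_univ_two]
  simp only [Matrix.vecMul, dotProduct, Fin.sum_univ_two, Matrix.cons_val_zero, Matrix.cons_val_one]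
  linear_combination (v 0 * T i 1 - v 1 * T i 0)⁻¹ * key

/-- As `T ^ 2 = s ^ 2`, for `e = ±s` each row of `T + e` is a left eigenvector of eigenvalue `e`,
and `T + e` has trace `2 * e ≠ 0`. The rows of `P` are two such eigenvectors. -/
lemma exists_conj_split (hp : p ≠ 2) {T : Matrix (Fin 2) (Fin 2) (ZMod p)} (ht : T.trace = 0)
    {s : ZMod p} (hs : s ≠ 0) (hd : T.det = -(s * s)) :
    ∃ P : GL (Fin 2) (ZMod p), P.1 * T = !![s, 0; 0, -s] * P.1 := by
  have h2 := two_ne_zero_zmod hp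
  have hT1 : T 1 1 = -T 0 0 := by rw [Matrix.trace_fin_two] at ht; linear_combination ht
  have hTT : T * T = (s * s) • (1 : Matrix (Fin 2) (Fin 2) (ZMod p)) := by
    rw [mul_self_fin_two, ht, hd]; simp
  have hrow : ∀ e : ZMod p, e * e = s * s → e ≠ 0 → ∃ w : Fin 2 → ZMod p, w ≠ 0 ∧
      w ᵥ* T = e • w := by
    intro e he he0
    have hne : T + e • (1 : Matrix (Fin 2) (Fin 2) (ZMod p)) ≠ 0 := by
      intro h
      have h' := congrArg Matrix.trace h
      rw [Matrix.trace_add, ht, Matrix.trace_smul, Matrix.trace_one] at h'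
      simp [he0, h2] at h'
    obtain ⟨i, hi⟩ := exists_row_ne_zero hne
    refine ⟨_, hi, ?_⟩
    have : (T + e • (1 : Matrix (Fin 2) (Fin 2) (ZMod p))) * T =
        e • (T + e • (1 : Matrix (Fin 2) (Fin 2) (ZMod p))) := by
      rw [add_mul, hTT, smul_mul_assoc, one_mul, smul_add, smul_smul, he, add_comm]
    exact congrFun this i
  obtain ⟨w, hw0, hw⟩ := hrow s rfl hs
  obtain ⟨v, hv0, hv⟩ := hrow (-s) (by ring) (neg_ne_zero.mpr hs)
  have hPT : (Matrix.of ![w, v]) * T = !![s, 0; 0, -s] * Matrix.of ![w, v] := by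
    ext i j
    have hwj := congrFun hw j
    have hvj := congrFun hv j
    simp only [Matrix.vecMul, dotProduct, Fin.sum_univ_two, Pi.smul_apply, smul_eq_mul] at hwj hvj
    fin_cases i <;> simp [Matrix.mul_apply, Fin.sum_univ_two, hwj, hvj]
  have hdet : (Matrix.of ![w, v]).det ≠ 0 := by
    intro h
    obtain ⟨u, hu0, hu⟩ := Matrix.exists_vecMul_eq_zero_iff.mpr h
    have hu' : u ᵥ* (!![s, 0; 0, -s] * Matrix.of ![w, v]) = 0 := by
      rw [← hPT, ← Matrix.vecMul_vecMul, hu, Matrix.zero_vecMul]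
    have a : ∀ j, u 0 * w j + u 1 * v j = 0 := fun j => by
      have := congrFun hu j
      simpa [Matrix.vecMul, dotProduct, Fin.sum_univ_two] using this
    have b : ∀ j, u 0 * (s * w j) + u 1 * (-(s * v j)) = 0 := fun j => by
      have := congrFun hu' j
      simpa [Matrix.vecMul, dotProduct, Fin.sum_univ_two, Matrix.mul_apply] using this
    have c0 : u 0 = 0 := by
      by_contra hc
      apply hw0
      ext j
      apply mul_left_cancel₀ (mul_ne_zero (mul_ne_zero h2 hs) hc)
      simp only [Pi.zero_apply, mul_zero]
      linear_combination s * a j + b j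
    have c1 : u 1 = 0 := by
      by_contra hc
      apply hv0
      ext j
      apply mul_left_cancel₀ hc
      have := a j
      rw [c0] at this
      simpa using this
    apply hu0
    ext i
    fin_cases i <;> simp [c0, c1]
  exact ⟨Matrix.GeneralLinearGroup.mkOfDetNeZero _ hdet, hPT⟩

/-- With rows `v T` and `v`, the relation `T ^ 2 = a` gives the companion form; only a cyclic vector
`v` is needed. -/
lemma exists_conj_nonsplit (hp : p ≠ 2) {T : Matrix (Fin 2) (Fin 2) (ZMod p)} (ht : T.trace = 0)
    {a : ZMod p} (ha : a ≠ 0) (hd : T.det = -a) :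
    ∃ P : GL (Fin 2) (ZMod p), P.1 * T = !![0, a; 1, 0] * P.1 := by
  have h2 := two_ne_zero_zmod hp
  have hT1 : T 1 1 = -T 0 0 := by rw [Matrix.trace_fin_two] at ht; linear_combination ht
  rw [Matrix.det_fin_two, hT1] at hd
  -- The determinant of the rows `v T` and `v` is a quadratic form in `v`. Vanishing at the three
  -- test vectors would force `T = 0`.
  obtain ⟨v, hv⟩ : ∃ v : Fin 2 → ZMod p,
      (v 0 * T 0 0 + v 1 * T 1 0) * v 1 - (v 0 * T 0 1 - v 1 * T 0 0) * v 0 ≠ 0 := by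
    by_contra! h
    have e1 := h ![1, 0]
    have e2 := h ![0, 1]
    have e3 := h ![1, 1]
    simp at e1 e2 e3
    apply ha
    rw [e1, e2] at e3
    have : T 0 0 = 0 := by
      apply mul_left_cancel₀ h2
      linear_combination e3
    rw [e1, this] at hd
    linear_combination hd
  refine ⟨Matrix.GeneralLinearGroup.mkOfDetNeZero
    !![v 0 * T 0 0 + v 1 * T 1 0, v 0 * T 0 1 - v 1 * T 0 0; v 0, v 1]
    (by rw [Matrix.det_fin_two_of]; exact hv), ?_⟩
  simp only [Matrix.GeneralLinearGroup.mkOfDetNeZero]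
  ext i j
  fin_cases i <;> fin_cases j <;> simp [Matrix.mul_apply, Fin.sum_univ_two, hT1]
  · linear_combination (-v 0) * hd
  · linear_combination (-v 1) * hd
  · ring

/-- A subgroup of `GL₂(𝔽_p)`, with `p` odd, that does not contain `-1` is conjugate to a subgroup
of a Borel subgroup or of the normalizer of a Cartan subgroup. -/
theorem exists_conj_le (hp : p ≠ 2) (hG : -1 ∉ G) (α : (ZMod p)ˣ)
    (hα : ∀ u : (ZMod p)ˣ, u ∈ Subgroup.zpowers α) :
    ∃ P : GL (Fin 2) (ZMod p), (∀ g ∈ G, P * g * P⁻¹ ∈ borelSubgroup (ZMod p)) ∨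
      (∀ g ∈ G, P * g * P⁻¹ ∈
        Subgroup.normalizer (splitCartan (ZMod p) : Set (GL (Fin 2) (ZMod p)))) ∨
      (∀ g ∈ G, P * g * P⁻¹ ∈
        Subgroup.normalizer (nonsplitCartan (α : ZMod p) : Set (GL (Fin 2) (ZMod p)))) := by
  obtain ⟨T, hT, ht, hTG⟩ := exists_semiinvariant hp hG
  by_cases hd : T.det = 0
  · obtain ⟨P, hP⟩ := exists_conj_le_borel hT ht hd hTG
    exact ⟨P, .inl hP⟩
  have hsign : ∀ {P : GL (Fin 2) (ZMod p)} {J : Matrix (Fin 2) (Fin 2) (ZMod p)},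
      P.1 * T = J * P.1 → ∀ g ∈ G, (P * g * P⁻¹).1 * J = J * (P * g * P⁻¹).1 ∨
        (P * g * P⁻¹).1 * J = -(J * (P * g * P⁻¹).1) := by
    intro P J hPJ g hg
    obtain ⟨c, hc⟩ := hTG g hg
    have h := conj_mul_eq_smul hPJ hc
    rcases sq_eq_one_of_mul_eq_smul hd hc with rfl | rfl
    · left; simpa using h
    · right; simpa using h
  -- The parity of the exponent of `-det T` tells squares from nonsquares. In the odd case `-det T =
  -- α * r ^ 2`, and dividing `T` by `r` gives determinant `-α`.
  obtain ⟨k, hk⟩ := Subgroup.mem_zpowers_iff.mp (hα (Units.mk0 (-T.det) (neg_ne_zero.mpr hd)))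
  have hk' := congrArg Units.val hk
  rw [Units.val_mk0] at hk'
  rcases Int.even_or_odd' k with ⟨j, rfl | rfl⟩
  · obtain ⟨P, hP⟩ := exists_conj_split hp ht (s := ((α ^ j : (ZMod p)ˣ) : ZMod p))
      (Units.ne_zero _) (by
        rw [two_mul, _root_.zpow_add, Units.val_mul] at hk'
        linear_combination hk')
    exact ⟨P, .inr (.inl fun g hg => mem_normalizer_of_sign
      (mem_splitCartan_iff hp (Units.ne_zero _)) (hsign hP g hg))⟩
  · obtain ⟨r, hr⟩ : ∃ r : (ZMod p)ˣ, r = α ^ j := ⟨_, rfl⟩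
    have hdet : ((r⁻¹ : (ZMod p)ˣ) : ZMod p) ^ 2 * T.det = -(α : ZMod p) := by
      rw [_root_.zpow_add, two_mul, _root_.zpow_add, ← hr, zpow_one, Units.val_mul, Units.val_mul] at hk'
      have h1 : (r : ZMod p) * ((r⁻¹ : (ZMod p)ˣ) : ZMod p) = 1 := r.mul_inv
      linear_combination ((r⁻¹ : (ZMod p)ˣ) : ZMod p) ^ 2 * hk' - (α : ZMod p) *
        ((r : ZMod p) * ((r⁻¹ : (ZMod p)ˣ) : ZMod p) + 1) * h1
    obtain ⟨P, hP⟩ := exists_conj_nonsplit hp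
      (T := ((r⁻¹ : (ZMod p)ˣ) : ZMod p) • T) (by rw [Matrix.trace_smul, ht, smul_zero])
      (Units.ne_zero α) (by rw [Matrix.det_smul, Fintype.card_fin, hdet])
    refine ⟨P, .inr (.inr fun g hg => mem_normalizer_of_sign
      mem_nonsplitCartan_iff ?_)⟩
    obtain ⟨c, hc⟩ := hTG g hg
    have h := conj_mul_eq_smul (c := c) hP (g := g) (by
      rw [mul_smul_comm, hc, smul_mul_assoc, smul_comm])
    rcases sq_eq_one_of_mul_eq_smul hd hc with rfl | rfl
    · left; simpa using h
    · right; simpa using h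

end Conjugation

end

/-! ### Addition and duplication formulas on a Weierstrass curve. -/

section

open WeierstrassCurve Affine

section XCoordinate

variable {F : Type*} [Field F] {W : Affine F}

/-- `(X : Z)` are homogeneous coordinates for the `x`-coordinate of `P`. -/
def RepX (P : W.Point) (X Z : F) : Prop :=
  match P with
  | .zero => Z = 0 ∧ X ≠ 0
  | .some x _ _ => Z ≠ 0 ∧ X = x * Z

/-- Numerator of the duplication formula. -/
def dblX {R : Type*} [CommRing R] (b₄ b₆ b₈ X Z : R) : R :=
  X ^ 4 - b₄ * X ^ 2 * Z ^ 2 - 2 * b₆ * X * Z ^ 3 - b₈ * Z ^ 4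

lemma negY_def (x y : F) : W.negY x y = -y - W.a₁ * x - W.a₃ := rfl

/-- The form `ψ = 2 * y + a₁ * x + a₃` is the denominator of the invariant differential `dx / ψ` and
vanishes exactly at the affine points of order two; its square depends on `x` alone. -/
lemma psi_sq {x y : F} (h : W.Equation x y) : (2 * y + W.a₁ * x + W.a₃) ^ 2 =
    4 * x ^ 3 + W.b₂ * x ^ 2 + 2 * W.b₄ * x + W.b₆ := by
  rw [equation_iff] at h
  simp only [b₂, b₄, b₆]
  linear_combination 4 * h

lemma psi_ne_zero_iff {x y : F} : y ≠ W.negY x y ↔ 2 * y + W.a₁ * x + W.a₃ ≠ 0 := by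
  rw [negY_def, Ne, Ne, not_iff_not]
  constructor <;> intro h <;> linear_combination h

variable [DecidableEq F]

/-- The duplication formula and the effect of duplication on the invariant differential. -/
lemma exists_two_nsmul {x y : F} (h : W.Nonsingular x y) (hy : 2 * y + W.a₁ * x + W.a₃ ≠ 0) :
    ∃ x' y' h', Point.some x y h + Point.some x y h = Point.some x' y' h' ∧
      x' * (2 * y + W.a₁ * x + W.a₃) ^ 2 =
        x ^ 4 - W.b₄ * x ^ 2 - 2 * W.b₆ * x - W.b₈ ∧
      (2 * y' + W.a₁ * x' + W.a₃) * (2 * y + W.a₁ * x + W.a₃) ^ 3 =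
        2 * x ^ 6 + W.b₂ * x ^ 5 + 5 * W.b₄ * x ^ 4 + 10 * W.b₆ * x ^ 3 + 10 * W.b₈ * x ^ 2 +
          (W.b₂ * W.b₈ - W.b₄ * W.b₆) * x + (W.b₄ * W.b₈ - W.b₆ ^ 2) := by
  have hne := psi_ne_zero_iff.mpr hy
  have he := (equation_iff _ _).mp h.1
  have ha₆ : W.a₆ = y ^ 2 + W.a₁ * x * y + W.a₃ * y - (x ^ 3 + W.a₂ * x ^ 2 + W.a₄ * x) := by
    linear_combination -he
  obtain ⟨s, hs⟩ : ∃ s, s = W.slope x x y y := ⟨_, rfl⟩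
  have hst : s * (2 * y + W.a₁ * x + W.a₃) = 3 * x ^ 2 + 2 * W.a₂ * x + W.a₄ - W.a₁ * y := by
    rw [hs, slope_of_Y_ne rfl hne, negY_def, div_mul_eq_mul_div, div_eq_iff]
    · ring
    · contrapose! hy; linear_combination hy
  have hX : W.addX x x s * (2 * y + W.a₁ * x + W.a₃) ^ 2 =
      x ^ 4 - W.b₄ * x ^ 2 - 2 * W.b₆ * x - W.b₈ := by
    simp only [addX, b₄, b₆, b₈]
    rw [ha₆]
    linear_combination (s * (2 * y + W.a₁ * x + W.a₃) + (3 * x ^ 2 + 2 * W.a₂ * x + W.a₄ - W.a₁ * y)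
      + W.a₁ * (2 * y + W.a₁ * x + W.a₃)) * hst
  refine ⟨_, _, _, Point.add_self_of_Y_ne hne, ?_⟩
  rw [← hs]
  refine ⟨hX, ?_⟩
  simp only [addY, negAddY, negY_def]
  generalize W.addX x x s = x' at hX ⊢
  simp only [b₂, b₄, b₆, b₈] at hX ⊢
  rw [ha₆] at hX ⊢
  linear_combination (-2 * (x' * (2 * y + W.a₁ * x + W.a₃) ^ 2 -
    x * (2 * y + W.a₁ * x + W.a₃) ^ 2)) * hst +
    (-2 * (3 * x ^ 2 + 2 * W.a₂ * x + W.a₄ - W.a₁ * y) -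
      W.a₁ * (2 * y + W.a₁ * x + W.a₃)) * hX

/-- The addition and subtraction formulas for the `x`-coordinate, and their effect on the invariant
differential. -/
lemma exists_add_sub {x₁ y₁ x₂ y₂ : F} (h₁ : W.Nonsingular x₁ y₁) (h₂ : W.Nonsingular x₂ y₂)
    (hx : x₁ ≠ x₂) :
    ∃ xs ys hs xd yd hd, Point.some x₁ y₁ h₁ + Point.some x₂ y₂ h₂ = Point.some xs ys hs ∧
      Point.some x₂ y₂ h₂ - Point.some x₁ y₁ h₁ = Point.some xd yd hd ∧
      (xs + xd) * (x₁ - x₂) ^ 2 =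
        2 * x₁ * x₂ * (x₁ + x₂) + W.b₂ * x₁ * x₂ + W.b₄ * (x₁ + x₂) + W.b₆ ∧
      ((2 * x₂ * (2 * x₁ + x₂) + W.b₂ * x₂ + W.b₄) * (x₁ - x₂) - 2 *
        (2 * x₁ * x₂ * (x₁ + x₂) + W.b₂ * x₁ * x₂ + W.b₄ * (x₁ + x₂) + W.b₆)) *
        (2 * y₁ + W.a₁ * x₁ + W.a₃) =
        ((2 * ys + W.a₁ * xs + W.a₃) - (2 * yd + W.a₁ * xd + W.a₃)) * (x₁ - x₂) ^ 3 ∧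
      ((2 * x₁ * (x₁ + 2 * x₂) + W.b₂ * x₁ + W.b₄) * (x₁ - x₂) + 2 *
        (2 * x₁ * x₂ * (x₁ + x₂) + W.b₂ * x₁ * x₂ + W.b₄ * (x₁ + x₂) + W.b₆)) *
        (2 * y₂ + W.a₁ * x₂ + W.a₃) =
        ((2 * ys + W.a₁ * xs + W.a₃) + (2 * yd + W.a₁ * xd + W.a₃)) * (x₁ - x₂) ^ 3 := by
  have he₁ := (equation_iff _ _).mp h₁.1
  have he₂ := (equation_iff _ _).mp h₂.1
  have hd0 : x₁ - x₂ ≠ 0 := sub_ne_zero.mpr hx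
  refine ⟨_, _, _, _, _, _, Point.add_of_X_ne hx,
    (sub_eq_add_neg _ _).trans
      (Point.add_of_X_ne (h₂ := (nonsingular_neg ..).mpr h₁) hx.symm), ?_⟩
  have ha₆ : W.a₆ = y₁ ^ 2 + W.a₁ * x₁ * y₁ + W.a₃ * y₁ -
      (x₁ ^ 3 + W.a₂ * x₁ ^ 2 + W.a₄ * x₁) := by
    linear_combination -he₁
  -- Two points with distinct `x` determine `a₄` and `a₆` from the other coefficients. After
  -- elimination the claims are identities of rational functions.
  have ha₄ : W.a₄ = (y₁ ^ 2 + W.a₁ * x₁ * y₁ + W.a₃ * y₁ - (x₁ ^ 3 + W.a₂ * x₁ ^ 2) -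
      (y₂ ^ 2 + W.a₁ * x₂ * y₂ + W.a₃ * y₂ - (x₂ ^ 3 + W.a₂ * x₂ ^ 2))) / (x₁ - x₂) := by
    rw [eq_div_iff hd0]
    linear_combination he₂ - he₁
  have hinv : (x₂ - x₁)⁻¹ = -(x₁ - x₂)⁻¹ := by rw [← inv_neg, neg_sub]
  rw [slope_of_X_ne hx, slope_of_X_ne hx.symm]
  simp only [addY, negAddY, addX, negY_def, b₂, b₄, b₆, ha₆, div_eq_mul_inv, hinv]
  rw [ha₄]
  generalize W.a₁ = a₁
  generalize W.a₂ = a₂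
  generalize W.a₃ = a₃
  refine ⟨?_, ?_, ?_⟩ <;> field_simp <;> ring

end XCoordinate

end

/-! ### The formulas in homogeneous `x`-coordinates. -/

section

open WeierstrassCurve Affine Polynomial

section XCoordinate

variable {F : Type*} [Field F] {W : Affine F}

lemma RepX.eq_zero_iff {P : W.Point} {X Z : F} (h : RepX P X Z) : P = 0 ↔ Z = 0 := by
  match P, h with
  | .zero, ⟨hZ, _⟩ => exact iff_of_true rfl hZ
  | .some x y hP, ⟨hZ, _⟩ => exact iff_of_false (Point.some_ne_zero _) hZ

/-- Denominator of the duplication formula. -/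
def dblZ {R : Type*} [CommRing R] (b₂ b₄ b₆ X Z : R) : R :=
  Z * (4 * X ^ 3 + b₂ * X ^ 2 * Z + 2 * b₄ * X * Z ^ 2 + b₆ * Z ^ 3)

variable [DecidableEq F]

lemma RepX.add_self {P : W.Point} {X Z : F} (h : RepX P X Z) :
    RepX (P + P) (dblX W.b₄ W.b₆ W.b₈ X Z) (dblZ W.b₂ W.b₄ W.b₆ X Z) := by
  match P, h with
  | .zero, ⟨hZ, hX⟩ =>
    rw [← Point.zero_def, add_zero]
    subst hZ
    exact ⟨by simp [dblZ], by simpa [dblX] using hX⟩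
  | .some x y hP, ⟨hZ, hX⟩ =>
    have hpsi := psi_sq hP.1
    subst hX
    by_cases hy : 2 * y + W.a₁ * x + W.a₃ = 0
    · rw [Point.add_self_of_Y_eq (by rw [negY_def]; linear_combination hy)]
      rw [hy] at hpsi
      refine ⟨?_, ?_⟩
      · rw [dblZ]
        linear_combination -Z ^ 4 * hpsi
      · obtain ⟨he, hns⟩ := (nonsingular_iff _ _).mp hP
        have hne : 3 * x ^ 2 + 2 * W.a₂ * x + W.a₄ - W.a₁ * y ≠ 0 := by
          rcases hns with hns | hns
          · intro h0
            exact hns (by linear_combination -h0)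
          · exact absurd (by linear_combination hy) hns
        have ha₆ : W.a₆ = y ^ 2 + W.a₁ * x * y + W.a₃ * y -
            (x ^ 3 + W.a₂ * x ^ 2 + W.a₄ * x) := by
          linear_combination -(equation_iff _ _).mp he
        -- At a point of order two the numerator is, up to `Z ^ 4`, the square of the partial
        -- derivative in `x`, nonzero by nonsingularity.
        have : dblX W.b₄ W.b₆ W.b₈ (x * Z) Z =
            Z ^ 4 * (3 * x ^ 2 + 2 * W.a₂ * x + W.a₄ - W.a₁ * y) ^ 2 := by
          simp only [dblX, b₄, b₆, b₈]
          rw [ha₆]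
          linear_combination (Z ^ 4 * (W.a₁ * (3 * x ^ 2 + 2 * W.a₂ * x + W.a₄ - W.a₁ * y) -
            (W.a₂ + 2 * x) * (2 * y + W.a₁ * x + W.a₃))) * hy
        rw [this]
        exact mul_ne_zero (pow_ne_zero _ hZ) (pow_ne_zero _ hne)
    · obtain ⟨x', y', h', hadd, hx', -⟩ := exists_two_nsmul hP hy
      rw [hadd]
      have hden : dblZ W.b₂ W.b₄ W.b₆ (x * Z) Z = Z ^ 4 * (2 * y + W.a₁ * x + W.a₃) ^ 2 := by
        rw [hpsi, dblZ]; ring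
      refine ⟨?_, ?_⟩
      · rw [hden]
        exact mul_ne_zero (pow_ne_zero _ hZ) (pow_ne_zero _ hy)
      · rw [hden, dblX]
        linear_combination -Z ^ 4 * hx'

/-- Numerator of `x(P + Q) + x(P - Q)`. -/
def sumX {R : Type*} [CommRing R] (b₂ b₄ b₆ X₁ Z₁ X₂ Z₂ : R) : R :=
  2 * (X₁ * X₂) * (X₁ * Z₂ + X₂ * Z₁) + b₂ * (X₁ * X₂ * (Z₁ * Z₂)) +
    b₄ * ((X₁ * Z₂ + X₂ * Z₁) * (Z₁ * Z₂)) + b₆ * (Z₁ * Z₂) ^ 2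

/-- The sum `x(P + Q) + x(P - Q)` is rational in the `x`-coordinates of `P` and `Q`, so knowing `x(Q
- P)` yields `x(P + Q)`. -/
lemma RepX.add_of_sub {P Q : W.Point} {X₁ Z₁ X₂ Z₂ x y : F} {h : W.Nonsingular x y}
    (hP : RepX P X₁ Z₁) (hQ : RepX Q X₂ Z₂) (hsub : Q - P = Point.some x y h) :
    RepX (P + Q) (sumX W.b₂ W.b₄ W.b₆ X₁ Z₁ X₂ Z₂ - x * (X₁ * Z₂ - X₂ * Z₁) ^ 2)
      ((X₁ * Z₂ - X₂ * Z₁) ^ 2) := by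
  match P, hP, Q, hQ with
  | .zero, ⟨hZ₁, hX₁⟩, Q, hQ =>
    rw [← Point.zero_def, sub_zero] at hsub
    subst hsub
    obtain ⟨hZ₂, hX₂⟩ := hQ
    rw [← Point.zero_def, zero_add]
    subst hZ₁ hX₂
    exact ⟨by simpa using ⟨hX₁, hZ₂⟩, by simp only [sumX]; ring⟩
  | .some x₁ y₁ h₁, ⟨hZ₁, hX₁⟩, .zero, ⟨hZ₂, hX₂⟩ =>
    rw [← Point.zero_def, zero_sub, Point.neg_some, Point.some.injEq] at hsub
    rw [← Point.zero_def, add_zero]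
    obtain ⟨rfl, -⟩ := hsub
    subst hZ₂ hX₁
    exact ⟨by simpa using ⟨hX₂, hZ₁⟩, by simp only [sumX]; ring⟩
  | .some x₁ y₁ h₁, ⟨hZ₁, hX₁⟩, .some x₂ y₂ h₂, ⟨hZ₂, hX₂⟩ =>
    subst hX₁ hX₂
    by_cases hx : x₁ = x₂
    · subst hx
      rcases (Point.X_eq_iff (h₁ := h₁) (h₂ := h₂)).mp rfl with heq | heq
      · rw [heq, sub_self] at hsub
        exact absurd hsub.symm (Point.some_ne_zero _)
      · rw [heq, neg_add_cancel]
        refine ⟨by ring, ?_⟩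
        have hpsi := psi_sq h₂.1
        -- Here `P = -Q`, so `Q - P = 2 • Q`, which is affine; hence `Q` does not have order two.
        have hy : 2 * y₂ + W.a₁ * x₁ + W.a₃ ≠ 0 := by
          intro hy
          have h0 := Point.add_self_of_Y_eq (h₁ := h₂) (by rw [negY_def]; linear_combination hy)
          rw [heq, sub_neg_eq_add, h0] at hsub
          exact absurd hsub.symm (Point.some_ne_zero _)
        have : sumX W.b₂ W.b₄ W.b₆ (x₁ * Z₁) Z₁ (x₁ * Z₂) Z₂ -
            x * (x₁ * Z₁ * Z₂ - x₁ * Z₂ * Z₁) ^ 2 =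
            (Z₁ * Z₂) ^ 2 * (2 * y₂ + W.a₁ * x₁ + W.a₃) ^ 2 := by
          rw [hpsi, sumX]; ring
        rw [this]
        exact mul_ne_zero (pow_ne_zero _ (mul_ne_zero hZ₁ hZ₂)) (pow_ne_zero _ hy)
    · obtain ⟨xs, ys, hs, xd, yd, hd, hadd, hsub', hX, -⟩ := exists_add_sub h₁ h₂ hx
      rw [hsub', Point.some.injEq] at hsub
      obtain ⟨rfl, rfl⟩ := hsub
      rw [hadd]
      refine ⟨?_, ?_⟩
      · have : x₁ * Z₁ * Z₂ - x₂ * Z₂ * Z₁ = (x₁ - x₂) * (Z₁ * Z₂) := by ring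
        rw [this]
        exact pow_ne_zero _ (mul_ne_zero (sub_ne_zero.mpr hx) (mul_ne_zero hZ₁ hZ₂))
      · rw [sumX]
        linear_combination (-(Z₁ * Z₂) ^ 2) * hX

end XCoordinate

/-! ### Bookkeeping of leading coefficients. -/

section Leading

variable {R : Type*} [CommRing R]

/-- `p` has degree at most `d` and its coefficient in degree `d` is `c`. -/
def HasLead (p : R[X]) (d : ℕ) (c : R) : Prop :=
  p.natDegree ≤ d ∧ p.coeff d = c

lemma HasLead.mul {p q : R[X]} {d e : ℕ} {a b : R} (hp : HasLead p d a) (hq : HasLead q e b) :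
    HasLead (p * q) (d + e) (a * b) :=
  ⟨natDegree_mul_le_of_le hp.1 hq.1, by
    rw [coeff_mul_add_eq_of_natDegree_le hp.1 hq.1, hp.2, hq.2]⟩

lemma HasLead.add {p q : R[X]} {d : ℕ} {a b : R} (hp : HasLead p d a) (hq : HasLead q d b) :
    HasLead (p + q) d (a + b) :=
  ⟨natDegree_add_le_of_degree_le hp.1 hq.1, by rw [coeff_add, hp.2, hq.2]⟩

lemma HasLead.sub {p q : R[X]} {d : ℕ} {a b : R} (hp : HasLead p d a) (hq : HasLead q d b) :
    HasLead (p - q) d (a - b) :=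
  ⟨natDegree_sub_le_of_le hp.1 hq.1 |>.trans (max_self d).le, by rw [coeff_sub, hp.2, hq.2]⟩

lemma HasLead.C_mul {p : R[X]} {d : ℕ} {a : R} (hp : HasLead p d a) (b : R) :
    HasLead (C b * p) d (b * a) :=
  ⟨(natDegree_C_mul_le _ _).trans hp.1, by rw [coeff_C_mul, hp.2]⟩

lemma HasLead.pow {p : R[X]} {d : ℕ} {a : R} (hp : HasLead p d a) (n : ℕ) :
    HasLead (p ^ n) (n * d) (a ^ n) :=
  ⟨natDegree_pow_le_of_le n hp.1, by rw [coeff_pow_of_natDegree_le hp.1, hp.2]⟩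

lemma HasLead.of_lt {p : R[X]} {d e : ℕ} {a : R} (hp : HasLead p d a) (h : d < e) :
    HasLead p e 0 :=
  ⟨hp.1.trans h.le, coeff_eq_zero_of_natDegree_lt (hp.1.trans_lt h)⟩

lemma HasLead.congr {p q : R[X]} {d e : ℕ} {a b : R} (hp : HasLead p d a) (hpq : p = q)
    (hd : d = e) (ha : a = b) : HasLead q e b := by
  subst hpq hd ha
  exact hp

end Leading

end

/-! ### Multiplication by `n` on `x`-coordinates. -/

section

open WeierstrassCurve Affine Polynomial

section Multiplication

variable {F : Type*} [Field F] {W : Affine F}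

lemma exists_some_of_ne_zero {P : W.Point} (hP : P ≠ 0) : ∃ x y h, P = Point.some x y h := by
  match P, hP with
  | .zero, hP => exact absurd rfl hP
  | .some x y h, _ => exact ⟨x, y, h, rfl⟩

variable [DecidableEq F]

/-- The polynomials `X` and `Z` express multiplication by `n` on `x`-coordinates: the leading terms
are `x ^ n ^ 2` and `n ^ 2 * x ^ (n ^ 2 - 1)`, the fraction `X / Z` gives the `x`-coordinate of
`n • P`, and multiplication by `n` multiplies the invariant differential by `n`. -/
structure IsMulPair (W : Affine F) (n : ℕ) (X Z : F[X]) : Prop where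
  lead : ∃ d, d + 1 = n ^ 2 ∧ HasLead X (d + 1) 1 ∧ HasLead Z d ((n : F) ^ 2)
  rep : ∀ {x y : F} (h : W.Nonsingular x y), RepX (n • Point.some x y h) (X.eval x) (Z.eval x)
  -- This is the derivative of `X / Z` multiplied by `ψ(P)` and equated with `n * ψ(n • P)`, cleared
  -- of denominators. The condition on `m` keeps the intermediate multiples affine, as the induction
  -- requires.
  diff : ∀ {x y : F} (h : W.Nonsingular x y),
    (∀ m, 1 ≤ m → m ≤ n → m • Point.some x y h ≠ 0) →
    ∀ {x' y' : F} {h' : W.Nonsingular x' y'}, n • Point.some x y h = Point.some x' y' h' →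
      (derivative X * Z - X * derivative Z).eval x * (2 * y + W.a₁ * x + W.a₃) =
        n * (2 * y' + W.a₁ * x' + W.a₃) * Z.eval x ^ 2

lemma isMulPair_one : IsMulPair W 1 X 1 where
  lead := ⟨0, by norm_num, ⟨by simp, by simp⟩, by simp [HasLead]⟩
  rep h := by
    rw [one_nsmul]
    simp [RepX]
  diff h _ x' y' h' he := by
    rw [one_nsmul, Point.some.injEq] at he
    obtain ⟨rfl, rfl⟩ := he
    simp

/-- The clause `diff` is the chain rule for `[2] ∘ [n]`, with the effect of `[2]` taken from
`exists_two_nsmul`. -/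
lemma IsMulPair.double {n : ℕ} {X Z : F[X]} (hn : 1 ≤ n) (h : IsMulPair W n X Z) :
    IsMulPair W (2 * n) (dblX (C W.b₄) (C W.b₆) (C W.b₈) X Z)
      (dblZ (C W.b₂) (C W.b₄) (C W.b₆) X Z) where
  lead := by
    obtain ⟨d, hd, hX, hZ⟩ := h.lead
    refine ⟨4 * d + 3, by linear_combination 4 * hd, ?_, ?_⟩
    · have h1 := ((hX.pow 2).mul (hZ.pow 2)).C_mul W.b₄
      have h2 := (hX.mul (hZ.pow 3)).C_mul (2 * W.b₆)
      have h3 := (hZ.pow 4).C_mul W.b₈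
      refine ((((hX.pow 4).sub (h1.of_lt (e := 4 * (d + 1)) (by omega))).sub
        (h2.of_lt (by omega))).sub (h3.of_lt (by omega))).congr ?_ (by ring) (by simp)
      rw [dblX, C_mul, map_ofNat]
      ring
    · have h0 := (hX.pow 3).C_mul 4
      have h1 := ((hX.pow 2).mul hZ).C_mul W.b₂
      have h2 := (hX.mul (hZ.pow 2)).C_mul (2 * W.b₄)
      have h3 := (hZ.pow 3).C_mul W.b₆
      refine (hZ.mul (((h0.add (h1.of_lt (e := 3 * (d + 1)) (by omega))).add
        (h2.of_lt (by omega))).add (h3.of_lt (by omega)))).congr ?_ (by ring) ?_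
      · rw [dblZ, C_mul, map_ofNat, map_ofNat]
        ring
      · push_cast
        ring
  rep {x y} hP := by
    have := (h.rep hP).add_self
    rw [← two_nsmul, smul_smul] at this
    convert this using 1 <;> simp [dblX, dblZ]
  diff {x y} hP hne x' y' h' he := by
    obtain ⟨x₁, y₁, h₁, hk⟩ := exists_some_of_ne_zero (hne n hn (by omega))
    have hd := h.diff hP (fun m hm hmn => hne m hm (by omega)) hk
    have hr := h.rep hP
    rw [hk] at hr
    obtain ⟨hZ, hX⟩ := hr
    have hψ : 2 * y₁ + W.a₁ * x₁ + W.a₃ ≠ 0 := by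
      intro h0
      apply Point.some_ne_zero h'
      rw [← he, mul_smul, hk, two_nsmul]
      exact Point.add_self_of_Y_eq (by rw [negY_def]; linear_combination h0)
    obtain ⟨x₂, y₂, h₂, hadd, -, hψ₂⟩ := exists_two_nsmul h₁ hψ
    rw [mul_smul, hk, two_nsmul, hadd, Point.some.injEq] at he
    obtain ⟨rfl, rfl⟩ := he
    have hsq := psi_sq h₁.1
    have hden : (dblZ (C W.b₂) (C W.b₄) (C W.b₆) X Z).eval x =
        Z.eval x ^ 4 * (2 * y₁ + W.a₁ * x₁ + W.a₃) ^ 2 := by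
      rw [hsq]
      simp [dblZ, hX]
      ring
    rw [hden]
    simp only [dblX, dblZ, derivative_mul, derivative_sub, derivative_add, derivative_pow,
      derivative_C, eval_sub, eval_add, eval_mul, eval_pow, eval_C, eval_natCast, eval_ofNat,
      derivative_ofNat, eval_zero, map_natCast] at hd ⊢
    rw [hX] at hd ⊢
    push_cast
    linear_combination (2 * eval x Z ^ 6 * (2 * x₁ ^ 6 + W.b₂ * x₁ ^ 5 + 5 * W.b₄ * x₁ ^ 4 +
      10 * W.b₆ * x₁ ^ 3 + 10 * W.b₈ * x₁ ^ 2 + (W.b₂ * W.b₈ - W.b₄ * W.b₆) * x₁ +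
      (W.b₄ * W.b₈ - W.b₆ ^ 2))) * hd -
      (2 * n * (2 * y₁ + W.a₁ * x₁ + W.a₃) * eval x Z ^ 8) * hψ₂ -
      2 * x₁ ^ 2 * eval x Z ^ 6 * (eval x (derivative X) * eval x Z -
        x₁ * eval x Z * eval x (derivative Z)) * (2 * y + W.a₁ * x + W.a₃) * W.b_relation

/-- The points `n • P` and `(n + 1) • P` differ by `P`, whose `x`-coordinate is the variable. The
leading coefficient is `2 * (n ^ 2 + (n + 1) ^ 2) - (2 * n + 1) ^ 2 = 1`. -/
lemma IsMulPair.succ_add {n : ℕ} {X₁ Z₁ X₂ Z₂ : F[X]} (hn : 1 ≤ n) (h₁ : IsMulPair W n X₁ Z₁)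
    (h₂ : IsMulPair W (n + 1) X₂ Z₂) :
    IsMulPair W (2 * n + 1)
      (sumX (C W.b₂) (C W.b₄) (C W.b₆) X₁ Z₁ X₂ Z₂ - X * (X₁ * Z₂ - X₂ * Z₁) ^ 2)
      ((X₁ * Z₂ - X₂ * Z₁) ^ 2) where
  lead := by
    obtain ⟨d, hd, hX₁, hZ₁⟩ := h₁.lead
    obtain ⟨e, he, hX₂, hZ₂⟩ := h₂.lead
    have hD := ((hX₁.mul hZ₂).sub ((hX₂.mul hZ₁).congr rfl
      (by omega : _ = d + 1 + e) rfl)).pow 2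
    refine ⟨2 * (d + 1 + e), by linear_combination 2 * hd + 2 * he, ?_, ?_⟩
    · have hX : HasLead (X : F[X]) 1 1 := ⟨natDegree_X_le, coeff_X_one⟩
      have hS := (hX₁.mul hZ₂).add ((hX₂.mul hZ₁).congr rfl (by omega : _ = d + 1 + e) rfl)
      have t₁ := ((hX₁.mul hX₂).mul hS).C_mul 2
      have t₂ := ((hX₁.mul hX₂).mul (hZ₁.mul hZ₂)).C_mul W.b₂
      have t₃ := (hS.mul (hZ₁.mul hZ₂)).C_mul W.b₄
      have t₄ := ((hZ₁.mul hZ₂).pow 2).C_mul W.b₆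
      refine ((((t₁.add (t₂.of_lt (by omega))).add (t₃.of_lt (by omega))).add
        (t₄.of_lt (by omega))).sub ((hX.mul hD).congr rfl (by omega) rfl)).congr ?_ (by omega) ?_
      · rw [sumX, map_ofNat]
        ring
      · push_cast
        ring
    · refine hD.congr rfl rfl ?_
      push_cast
      ring
  rep {x y} hP := by
    have := (h₁.rep hP).add_of_sub (h₂.rep hP) (h := hP) (by rw [succ_nsmul]; abel)
    rw [← add_smul] at this
    have hn' : n + (n + 1) = 2 * n + 1 := by ring
    rw [hn'] at this
    convert this using 1 <;> simp [sumX]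
  diff {x y} hP hne x' y' h' he := by
    obtain ⟨x₁, y₁, hP₁, hk₁⟩ := exists_some_of_ne_zero (hne n hn (by omega))
    obtain ⟨x₂, y₂, hP₂, hk₂⟩ := exists_some_of_ne_zero (hne (n + 1) (by omega) (by omega))
    have hd₁ := h₁.diff hP (fun m hm hmn => hne m hm (by omega)) hk₁
    have hd₂ := h₂.diff hP (fun m hm hmn => hne m hm (by omega)) hk₂
    have hr₁ := h₁.rep hP
    have hr₂ := h₂.rep hP
    rw [hk₁] at hr₁
    rw [hk₂] at hr₂
    obtain ⟨hZ₁, hX₁⟩ := hr₁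
    obtain ⟨hZ₂, hX₂⟩ := hr₂
    have hsum : Point.some x₁ y₁ hP₁ + Point.some x₂ y₂ hP₂ = Point.some x' y' h' := by
      rw [← hk₁, ← hk₂, ← he, ← add_smul]
      congr 1
      ring
    have hsub : Point.some x₂ y₂ hP₂ - Point.some x₁ y₁ hP₁ = Point.some x y hP := by
      rw [← hk₁, ← hk₂, succ_nsmul]
      abel
    have hx : x₁ ≠ x₂ := by
      intro hx
      rcases (Point.X_eq_iff (h₁ := hP₁) (h₂ := hP₂)).mp hx with heq | heq
      · rw [heq, sub_self] at hsub
        exact Point.some_ne_zero _ hsub.symm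
      · rw [heq, neg_add_cancel] at hsum
        exact Point.some_ne_zero _ hsum.symm
    obtain ⟨xs, ys, hs, xd, yd, hd, hadd, hsub', -, hψ₁, hψ₂⟩ := exists_add_sub hP₁ hP₂ hx
    rw [hadd, Point.some.injEq] at hsum
    rw [hsub', Point.some.injEq] at hsub
    obtain ⟨rfl, rfl⟩ := hsum
    obtain ⟨rfl, rfl⟩ := hsub
    simp only [sumX, derivative_mul, derivative_sub, derivative_add, derivative_pow,
      derivative_C, derivative_X, eval_sub, eval_add, eval_mul, eval_pow, eval_C, eval_X,
      eval_natCast, eval_ofNat, eval_one, derivative_ofNat, eval_zero, map_natCast] at hd₁ hd₂ ⊢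
    rw [hX₁] at hd₁ ⊢
    rw [hX₂] at hd₂ ⊢
    push_cast at hd₂ ⊢
    generalize eval xd Z₁ = z₁ at *
    generalize eval xd Z₂ = z₂ at *
    linear_combination
      ((x₁ - x₂) * z₁ ^ 2 * z₂ ^ 4 * ((2 * x₂ * (2 * x₁ + x₂) + W.b₂ * x₂ + W.b₄) * (x₁ - x₂) - 2 *
        (2 * x₁ * x₂ * (x₁ + x₂) + W.b₂ * x₁ * x₂ + W.b₄ * (x₁ + x₂) + W.b₆))) * hd₁ +
      ((x₁ - x₂) * z₁ ^ 4 * z₂ ^ 2 * ((2 * x₁ * (x₁ + 2 * x₂) + W.b₂ * x₁ + W.b₄) * (x₁ - x₂) + 2 *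
        (2 * x₁ * x₂ * (x₁ + x₂) + W.b₂ * x₁ * x₂ + W.b₄ * (x₁ + x₂) + W.b₆))) * hd₂ +
      ((x₁ - x₂) * z₁ ^ 4 * z₂ ^ 4 * n) * hψ₁ + ((x₁ - x₂) * z₁ ^ 4 * z₂ ^ 4 * (n + 1)) * hψ₂

lemma exists_isMulPair (W : Affine F) (n : ℕ) (hn : 1 ≤ n) : ∃ X Z : F[X], IsMulPair W n X Z := by
  induction n using Nat.strong_induction_on with
  | _ n ih =>
    rcases Nat.even_or_odd' n with ⟨k, rfl | rfl⟩
    · obtain ⟨X, Z, h⟩ := ih k (by omega) (by omega)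
      exact ⟨_, _, h.double (by omega)⟩
    · rcases Nat.eq_zero_or_pos k with rfl | hk
      · exact ⟨_, _, isMulPair_one⟩
      · obtain ⟨X₁, Z₁, h₁⟩ := ih k (by omega) hk
        obtain ⟨X₂, Z₂, h₂⟩ := ih (k + 1) (by omega) (by omega)
        exact ⟨_, _, h₁.succ_add hk h₂⟩

end Multiplication

end

/-! ### Counting torsion points of odd order. -/

section

open WeierstrassCurve Affine Polynomial

lemma eq_zero_of_odd_nsmul {A : Type*} [AddCommGroup A] {n : ℕ} (hn : Odd n) {P : A}
    (h : n • P = 0) (hP : P = -P) : P = 0 := by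
  obtain ⟨k, rfl⟩ := hn
  have h2 : 2 • P = 0 := by
    rw [two_nsmul]
    nth_rewrite 2 [hP]
    exact add_neg_cancel P
  rwa [add_smul, mul_comm, mul_smul, h2, smul_zero, zero_add, one_nsmul] at h

section Counting

variable {F : Type*} [Field F]

/-- A double root criterion: if the square of the Wronskian of `X` and `Z` is divisible by `Z`
exactly to the first order at a root `r`, then `r` is a double root. -/
lemma rootMultiplicity_eq_two [CharZero F] {X Z f U : F[X]} {r : F} (hZ0 : Z ≠ 0)
    (hZ : Z.eval r = 0) (hX : X.eval r ≠ 0) (hf : f.eval r ≠ 0) (hU : U.eval r ≠ 0)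
    (h : (derivative X * Z - X * derivative Z) ^ 2 * f = Z * U) : Z.rootMultiplicity r = 2 := by
  obtain ⟨Q, hQ, hQr⟩ := exists_eq_pow_rootMultiplicity_mul_and_not_dvd Z hZ0 r
  rw [dvd_iff_isRoot, IsRoot.def] at hQr
  obtain ⟨m, hm⟩ : ∃ m, Z.rootMultiplicity r = m + 1 :=
    Nat.exists_eq_succ_of_ne_zero ((rootMultiplicity_pos hZ0).mpr hZ).ne'
  rw [hm] at hQ ⊢
  -- `V` is the Wronskian divided by `(x - r) ^ m`. Its value at `r` is `-(m + 1) * X(r) * Q(r)`,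
  -- nonzero in characteristic zero. Comparing multiplicities gives `2 * m = m + 1`.
  obtain ⟨V, hV⟩ : ∃ V, V = derivative X * ((Polynomial.X - C r) * Q) -
      X * (C ((m : F) + 1) * Q + (Polynomial.X - C r) * derivative Q) := ⟨_, rfl⟩
  have hW : derivative X * Z - X * derivative Z = (Polynomial.X - C r) ^ m * V := by
    rw [hQ, hV, derivative_mul, derivative_pow_succ, derivative_sub, derivative_X, derivative_C]
    simp only [map_add, map_natCast, map_one]
    ring
  have hVr : V.eval r ≠ 0 := by
    have hm' : (m : F) + 1 ≠ 0 := by exact_mod_cast Nat.succ_ne_zero m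
    rw [hV]
    simp [hX, hQr, hm']
  have hmul : ∀ (k : ℕ) {p : F[X]}, p.eval r ≠ 0 →
      ((Polynomial.X - C r) ^ k * p).rootMultiplicity r = k := by
    intro k p hp
    have hp0 : p ≠ 0 := by
      rintro rfl
      simp at hp
    rw [rootMultiplicity_mul (mul_ne_zero (pow_ne_zero _ (X_sub_C_ne_zero r)) hp0),
      rootMultiplicity_X_sub_C_pow, rootMultiplicity_eq_zero hp, add_zero]
  have h1 := hmul (2 * m) (p := V ^ 2 * f) (by
    rw [eval_mul, eval_pow]
    exact mul_ne_zero (pow_ne_zero _ hVr) hf)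
  have h2 := hmul (m + 1) (p := Q * U) (by
    rw [eval_mul]
    exact mul_ne_zero hQr hU)
  rw [hW, hQ] at h
  have heq : (Polynomial.X - C r) ^ (2 * m) * (V ^ 2 * f) =
      (Polynomial.X - C r) ^ (m + 1) * (Q * U) := by
    rw [← mul_assoc _ Q U, ← h]
    ring
  rw [heq, h2] at h1
  omega

variable [DecidableEq F] {W : Affine F}

lemma IsMulPair.eval_denominator_eq_zero_iff {n : ℕ} {X Z : F[X]} (hXZ : IsMulPair W n X Z)
    {x y : F} (h : W.Nonsingular x y) : Z.eval x = 0 ↔ n • Point.some x y h = 0 :=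
  (hXZ.rep h).eq_zero_iff.symm

lemma IsMulPair.denominator_ne_zero [CharZero F] {n : ℕ} {X Z : F[X]} (hn : 1 ≤ n)
    (hXZ : IsMulPair W n X Z) : Z ≠ 0 := by
  rintro rfl
  obtain ⟨d, -, -, -, h⟩ := hXZ.lead
  rw [coeff_zero] at h
  exact pow_ne_zero 2 (Nat.cast_ne_zero.mpr (by omega : n ≠ 0)) h.symm

variable [CharZero F] [IsAlgClosed F] [W.IsElliptic]

omit [DecidableEq F] in
variable (W) in
lemma exists_nonsingular (x : F) : ∃ y, W.Nonsingular x y := by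
  obtain ⟨s, hs⟩ := IsAlgClosed.exists_eq_mul_self
    (4 * x ^ 3 + W.b₂ * x ^ 2 + 2 * W.b₄ * x + W.b₆)
  refine ⟨(s - W.a₁ * x - W.a₃) / 2, equation_iff_nonsingular.mp ((equation_iff _ _).mpr ?_)⟩
  simp only [b₂, b₄, b₆] at hs
  linear_combination -hs / 4

/-- Squaring `diff` turns both `ψ ^ 2` into cubics in `x`, so `y` disappears. -/
lemma IsMulPair.wronskian_sq {n : ℕ} {X Z : F[X]} (hn : 1 ≤ n) (hXZ : IsMulPair W n X Z) :
    (derivative X * Z - X * derivative Z) ^ 2 *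
      (4 * Polynomial.X ^ 3 + C W.b₂ * Polynomial.X ^ 2 + 2 * C W.b₄ * Polynomial.X + C W.b₆) =
    Z * (C ((n : F) ^ 2) * (4 * X ^ 3 + C W.b₂ * X ^ 2 * Z + 2 * C W.b₄ * X * Z ^ 2 +
      C W.b₆ * Z ^ 3)) := by
  have hex : ∀ m : ℕ, ∃ Y : F[X], 1 ≤ m → Y ≠ 0 ∧ ∀ {x y : F} (h : W.Nonsingular x y),
      Y.eval x = 0 ↔ m • Point.some x y h = 0 := by
    intro m
    by_cases hm : 1 ≤ m
    · obtain ⟨X', Z', h⟩ := exists_isMulPair W m hm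
      exact ⟨Z', fun _ => ⟨h.denominator_ne_zero hm, h.eval_denominator_eq_zero_iff⟩⟩
    · exact ⟨0, fun h => absurd h hm⟩
  choose Y hY using hex
  -- This nonzero factor vanishes at every `x` where some multiple `m • P` with `1 ≤ m ≤ n` is zero
  -- and `diff` does not apply.
  have hprod : ∏ m ∈ Finset.Icc 1 n, Y m ≠ 0 :=
    Finset.prod_ne_zero_iff.mpr fun m hm => (hY m (Finset.mem_Icc.mp hm).1).1
  apply mul_left_cancel₀ hprod
  apply Polynomial.funext
  intro x
  rw [eval_mul, eval_mul (q := Z * _), eval_prod]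
  by_cases hx : ∏ m ∈ Finset.Icc 1 n, (Y m).eval x = 0
  · rw [hx, zero_mul, zero_mul]
  congr 1
  rw [Finset.prod_eq_zero_iff] at hx
  push Not at hx
  obtain ⟨y, h⟩ := exists_nonsingular W x
  have hne : ∀ m, 1 ≤ m → m ≤ n → m • Point.some x y h ≠ 0 := fun m hm hmn h0 =>
    hx m (Finset.mem_Icc.mpr ⟨hm, hmn⟩) (((hY m hm).2 h).mpr h0)
  obtain ⟨x', y', h', hk⟩ := exists_some_of_ne_zero (hne n hn le_rfl)
  have hd := hXZ.diff h hne hk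
  have hr := hXZ.rep h
  rw [hk] at hr
  obtain ⟨-, hX⟩ := hr
  have h1 := psi_sq h.1
  have h2 := psi_sq h'.1
  simp only [eval_mul, eval_pow, eval_add, eval_sub, eval_C, eval_X, eval_ofNat] at hd ⊢
  rw [← h1, ← mul_pow, hd, hX, mul_pow, mul_pow, h2]
  ring

/-- Over an algebraically closed field of characteristic zero, an elliptic curve has `n ^ 2` points
of order dividing an odd number `n`. -/
theorem card_torsion {n : ℕ} (hn : Odd n) :
    Nat.card {P : W.Point // n • P = 0} = n ^ 2 := by
  have hn1 : 1 ≤ n := hn.pos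
  obtain ⟨X, Z, hXZ⟩ := exists_isMulPair W n hn1
  have hZ0 := hXZ.denominator_ne_zero hn1
  choose y hy using exists_nonsingular W
  have hnF : (n : F) ≠ 0 := Nat.cast_ne_zero.mpr (by omega)
  have hneg : ∀ P : W.Point, P ≠ 0 → n • P = 0 → P ≠ -P := fun P hP hnP heq =>
    hP (eq_zero_of_odd_nsmul hn hnP heq)
  have hroot : ∀ x ∈ Z.roots.toFinset, n • Point.some x (y x) (hy x) = 0 := by
    intro x hx
    rw [Multiset.mem_toFinset, mem_roots hZ0, IsRoot.def,
      hXZ.eval_denominator_eq_zero_iff (hy x)] at hx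
    exact hx
  -- Since `n` is odd, no nonzero point killed by `n` has order two, so the cubic `ψ ^ 2` is nonzero
  -- at the roots of `Z`.
  have hmult : ∀ x ∈ Z.roots.toFinset, Z.roots.count x = 2 := by
    intro x hx
    have h0 := hroot x hx
    rw [Multiset.mem_toFinset, mem_roots hZ0, IsRoot.def] at hx
    have hX : X.eval x ≠ 0 := by
      have := hXZ.rep (hy x)
      rw [h0] at this
      exact this.2
    rw [count_roots]
    refine rootMultiplicity_eq_two hZ0 hx hX ?_ ?_ (hXZ.wronskian_sq hn1)
    · simp only [eval_mul, eval_pow, eval_add, eval_C, eval_X, eval_ofNat]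
      rw [← psi_sq (hy x).1]
      refine pow_ne_zero _ fun hpsi => hneg _ (Point.some_ne_zero (hy x)) h0 ?_
      rw [Point.neg_some, Point.some.injEq]
      exact ⟨rfl, by rw [negY_def]; linear_combination hpsi⟩
    · simp only [eval_mul, eval_pow, eval_add, eval_C, eval_ofNat, hx]
      simpa using ⟨by omega, hX⟩
  -- `Z` has degree `n ^ 2 - 1` and splits with all roots double; the missing `1` is the point at
  -- infinity.
  have hcard : 2 * Z.roots.toFinset.card + 1 = n ^ 2 := by
    obtain ⟨d, hd, -, hlead⟩ := hXZ.lead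
    have hdeg : Z.natDegree = d :=
      le_antisymm hlead.1 (le_natDegree_of_ne_zero (by rw [hlead.2]; exact pow_ne_zero _ hnF))
    have hs := Multiset.toFinset_sum_count_eq Z.roots
    rw [Finset.sum_congr rfl hmult, Finset.sum_const, smul_eq_mul,
      ← splits_iff_card_roots.mp (IsAlgClosed.splits Z)] at *
    omega
  obtain ⟨S, hS⟩ : ∃ S : Finset W.Point, S = insert 0 (Z.roots.toFinset.biUnion fun x =>
    {Point.some x (y x) (hy x), -Point.some x (y x) (hy x)}) := ⟨_, rfl⟩
  have hmem : ∀ P : W.Point, P ∈ S ↔ n • P = 0 := by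
    intro P
    rw [hS, Finset.mem_insert, Finset.mem_biUnion]
    constructor
    · rintro (rfl | ⟨x, hx, hP⟩)
      · exact smul_zero _
      · rw [Finset.mem_insert, Finset.mem_singleton] at hP
        rcases hP with rfl | rfl
        · exact hroot x hx
        · rw [smul_neg, hroot x hx, neg_zero]
    · intro hP
      match P, hP with
      | .zero, _ => exact .inl rfl
      | .some x y' h, hP =>
        refine .inr ⟨x, ?_, ?_⟩
        · rw [Multiset.mem_toFinset, mem_roots hZ0, IsRoot.def,
            hXZ.eval_denominator_eq_zero_iff h]
          exact hP
        · rw [Finset.mem_insert, Finset.mem_singleton]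
          exact Point.X_eq_iff.mp rfl
  have hScard : S.card = n ^ 2 := by
    rw [hS, Finset.card_insert_of_notMem, Finset.card_biUnion, ← hcard]
    · rw [Finset.sum_congr rfl fun x hx => Finset.card_pair
        (hneg _ (Point.some_ne_zero (hy x)) (hroot x hx)), Finset.sum_const, smul_eq_mul, mul_comm]
    · intro a _ b _ hab
      rw [Function.onFun, Finset.disjoint_left]
      intro P hPa hPb
      apply hab
      simp only [Finset.mem_insert, Finset.mem_singleton, Point.neg_some] at hPa hPb
      rcases hPa with rfl | rfl <;> rcases hPb with h | h <;>
        exact ((Point.some.injEq ..).mp h).1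
    · simp only [Finset.mem_biUnion, Finset.mem_insert, Finset.mem_singleton, not_exists, not_and,
        not_or, Point.neg_some]
      exact fun x _ => ⟨(Point.some_ne_zero _).symm, (Point.some_ne_zero _).symm⟩
  rw [← hScard]
  exact Nat.subtype_card S hmem

end Counting

end

/-! ### The Galois action and the degree of `K(R)`. -/

section

open WeierstrassCurve Affine Polynomial Matrix

section Galois

variable {K : Type*} [Field K] (E : WeierstrassCurve K) (Ω : Type*) [Field Ω] [Algebra K Ω]
  [DecidableEq Ω]

/-- The `p`-torsion of an elliptic curve over an algebraically closed field of characteristic zero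
is a plane over `𝔽_p`. -/
lemma exists_basis_torsion [CharZero Ω] [IsAlgClosed Ω] [E.IsElliptic] {p : ℕ} [Fact p.Prime]
    (hp : p ≠ 2) : Nonempty (Module.Basis (Fin 2) (ZMod p) (torsion E Ω p)) := by
  have : (E.baseChange Ω).toAffine.IsElliptic :=
    inferInstanceAs (WeierstrassCurve.IsElliptic (E.map (algebraMap K Ω)))
  have hcard : Nat.card (torsion E Ω p) = p ^ 2 := by
    rw [← card_torsion (W := (E.baseChange Ω).toAffine)
      ((Fact.out : p.Prime).odd_of_ne_two hp)]
    exact Nat.card_congr (Equiv.subtypeEquivRight fun P => AddSubgroup.torsionBy.nsmul_iff)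
  have hfin : Finite (torsion E Ω p) :=
    Nat.finite_of_card_ne_zero (by rw [hcard]; exact pow_ne_zero _ (Fact.out : p.Prime).ne_zero)
  have hrank : Module.finrank (ZMod p) (torsion E Ω p) = 2 := by
    have h := Module.natCard_eq_pow_finrank (K := ZMod p) (V := torsion E Ω p)
    rw [hcard, Nat.card_zmod] at h
    exact (Nat.pow_right_injective (Fact.out : p.Prime).two_le h).symm
  exact ⟨Module.finBasisOfFinrankEq _ _ hrank⟩

variable {E Ω}

lemma rho_apply {n : ℕ} (B : Module.Basis (Fin 2) (ZMod n) (torsion E Ω n))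
    (σ : (Gal(torsionField E Ω n/K))ᵐᵒᵖ) (i j : Fin 2) :
    (rho B σ).1 i j = B.repr (galAction E Ω n σ.unop (B i)) j :=
  rfl

lemma repr_galAction {n : ℕ} (B : Module.Basis (Fin 2) (ZMod n) (torsion E Ω n))
    (σ : (Gal(torsionField E Ω n/K))ᵐᵒᵖ) (v : torsion E Ω n) :
    ⇑(B.repr (galAction E Ω n σ.unop v)) = ⇑(B.repr v) ᵥ* (rho B σ).1 := by
  ext j
  conv_lhs => rw [← B.sum_repr v, Fin.sum_univ_two]
  simp [Matrix.vecMul, dotProduct, rho_apply]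

/-- Changing the basis conjugates the image of Galois. -/
lemma exists_basis_rho_conj {n : ℕ} (B : Module.Basis (Fin 2) (ZMod n) (torsion E Ω n))
    (P : GL (Fin 2) (ZMod n)) :
    ∃ B' : Module.Basis (Fin 2) (ZMod n) (torsion E Ω n),
      ∀ σ, rho B' σ = P * rho B σ * P⁻¹ := by
  -- Coordinates are rows, so a basis whose vectors have the rows of `P` as coordinates changes
  -- coordinate rows by `P⁻¹` on the right.
  obtain ⟨L, hL⟩ : ∃ L : (Fin 2 → ZMod n) ≃ₗ[ZMod n] (Fin 2 → ZMod n),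
      (∀ v, L v = v ᵥ* P⁻¹.1) ∧ ∀ v, L.symm v = v ᵥ* P.1 :=
    ⟨{ Matrix.vecMulLinear P⁻¹.1 with
        invFun := fun v => v ᵥ* P.1
        left_inv := fun v => by
          change (v ᵥ* P⁻¹.1) ᵥ* P.1 = v
          rw [Matrix.vecMul_vecMul, ← Units.val_mul, inv_mul_cancel, Units.val_one,
            Matrix.vecMul_one]
        right_inv := fun v => by
          change (v ᵥ* P.1) ᵥ* P⁻¹.1 = v
          rw [Matrix.vecMul_vecMul, ← Units.val_mul, mul_inv_cancel, Units.val_one,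
            Matrix.vecMul_one] }, fun _ => rfl, fun _ => rfl⟩
  obtain ⟨B', hB'⟩ : ∃ B', B' = Module.Basis.ofEquivFun (B.equivFun.trans L) := ⟨_, rfl⟩
  have hrepr : ∀ v, ⇑(B'.repr v) = ⇑(B.repr v) ᵥ* P⁻¹.1 := by
    intro v
    rw [hB', ← hL.1]
    ext j
    simp
  have happly : ∀ i, ⇑(B.repr (B' i)) = P.1 i := by
    intro i
    have h := hrepr (B' i)
    rw [B'.repr_self] at h
    have h' := congrArg (· ᵥ* P.1) h
    simp only [Matrix.vecMul_vecMul, ← Units.val_mul, inv_mul_cancel, Units.val_one,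
      Matrix.vecMul_one] at h'
    rw [← h', Finsupp.single_eq_pi_single, Matrix.single_one_vecMul]
    rfl
  refine ⟨B', fun σ => ?_⟩
  ext i j
  rw [rho_apply, hrepr, repr_galAction, happly, Matrix.vecMul_vecMul, mul_assoc, Units.val_mul,
    Units.val_mul]
  rfl

/-- An automorphism whose matrix is `-1` acts as `-1` on the torsion. -/
lemma galAction_eq_neg_of_rho {n : ℕ} (B : Module.Basis (Fin 2) (ZMod n) (torsion E Ω n))
    {σ : (Gal(torsionField E Ω n/K))ᵐᵒᵖ} (hσ : rho B σ = -1) (P : torsion E Ω n) :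
    galAction E Ω n σ.unop P = -P := by
  have : galAction E Ω n σ.unop = -1 := by
    apply B.ext
    intro i
    apply B.repr.injective
    ext j
    rw [← rho_apply, hσ]
    simp [Matrix.one_apply, Finsupp.single_apply]
  rw [this]
  simp

omit [DecidableEq Ω] in
/-- If `y` is a root of a monic quadratic polynomial over `K(x)` but not an element of `K(x)`, then
`K(x, y)` has even degree over `K`. -/
lemma two_dvd_finrank_adjoin_pair {x y : Ω} (hy : y ∉ IntermediateField.adjoin K {x})
    {b c : IntermediateField.adjoin K {x}} (h : y ^ 2 + b * y + c = 0) :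
    2 ∣ Module.finrank K (IntermediateField.adjoin K {x, y}) := by
  rw [← IntermediateField.adjoin_simple_adjoin_simple]
  let M := IntermediateField.adjoin K {x}
  have hq : aeval y (X ^ 2 + C b * X + C c : M[X]) = 0 := by
    simpa using h
  have hdeg : (X ^ 2 + C b * X + C c : M[X]).natDegree = 2 := by
    compute_degree!
  have hmonic : (X ^ 2 + C b * X + C c : M[X]).Monic := by
    monicity!
  have hint : IsIntegral M y := ⟨_, hmonic, hq⟩
  have hmin : (minpoly M y).natDegree = 2 := by
    apply le_antisymm
    · rw [← hdeg]
      exact natDegree_le_natDegree (minpoly.min M y hmonic hq)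
    · rw [minpoly.two_le_natDegree_iff hint]
      rintro ⟨z, rfl⟩
      exact hy z.2
  have h2 : Module.finrank M (IntermediateField.adjoin M {y}) = 2 := by
    rw [IntermediateField.adjoin.finrank hint, hmin]
  have htower := Module.finrank_mul_finrank K M (IntermediateField.adjoin M {y})
  rw [h2] at htower
  exact ⟨_, by rw [mul_comm]; exact htower.symm⟩

/-- Here `σ` fixes `K(x)` pointwise but moves `y`, because `R ≠ -R` for odd `n`. The Weierstrass
equation is a monic quadratic for `y` over `K(x)`. -/
lemma two_dvd_finrank_pointField {n : ℕ} (hn : Odd n) {σ : Gal(torsionField E Ω n/K)}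
    {R : torsion E Ω n} (hR : (R : Pt E Ω) ≠ 0) (hσ : galAction E Ω n σ R = -R) :
    2 ∣ Module.finrank K (pointField (R : Pt E Ω)) := by
  obtain ⟨Q, rfl⟩ := (torsionEquiv E Ω n).surjective R
  have hact : galAction E Ω n σ (torsionEquiv E Ω n Q) =
      torsionEquiv E Ω n (torsionMap E σ.toAlgHom n Q) := by
    simp [galAction]
  have hQ : torsionMap E σ.toAlgHom n Q = -Q := by
    apply (torsionEquiv E Ω n).injective
    rw [← hact, hσ, map_neg]
  have hQ' : Affine.Point.map (W' := E.toAffine) σ.toAlgHom Q.1 = -Q.1 := by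
    have := congrArg Subtype.val hQ
    simpa using this
  have htor : n • Q.1 = 0 := AddSubgroup.torsionBy.nsmul_iff.mp Q.2
  have hval : ((torsionEquiv E Ω n Q : torsion E Ω n) : Pt E Ω) =
      Affine.Point.map (W' := E.toAffine) (torsionField E Ω n).val Q.1 := rfl
  rw [hval] at hR ⊢
  generalize Q.1 = Q₀ at hQ' htor hR ⊢
  match Q₀, hQ', htor, hR with
  | .zero, _, _, hR => exact absurd rfl hR
  | .some x y h, hQ', htor, _ =>
    have hne : Point.some x y h ≠ -Point.some x y h := fun heq =>
      Point.some_ne_zero _ (eq_zero_of_odd_nsmul hn htor heq)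
    rw [Point.map_some, Point.neg_some, Point.some.injEq] at hQ'
    obtain ⟨hx, hy⟩ := hQ'
    have hy' : σ y ≠ y := by
      intro hy'
      apply hne
      rw [Point.neg_some, Point.some.injEq]
      exact ⟨rfl, hy'.symm.trans hy⟩
    have hfix : ∀ z ∈ IntermediateField.adjoin K {x}, σ z = z := by
      intro z hz
      induction hz using IntermediateField.adjoin_induction with
      | mem z hz => rw [Set.mem_singleton_iff] at hz; subst hz; exact hx
      | algebraMap z => exact σ.commutes z
      | add a b _ _ ha hb => rw [map_add, ha, hb]
      | inv a _ ha => rw [map_inv₀, ha]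
      | mul a b _ _ ha hb => rw [map_mul, ha, hb]
    have hnot : (y : Ω) ∉ IntermediateField.adjoin K {(x : Ω)} := by
      intro hmem
      -- `σ` acts only on `K(E[n])`, so `K(x)` inside `Ω` is identified with the image of `K(x)`
      -- inside `K(E[n])`.
      have hmap := IntermediateField.adjoin_map K {x} (torsionField E Ω n).val
      rw [Set.image_singleton] at hmap
      change (y : Ω) ∈ IntermediateField.adjoin K {(torsionField E Ω n).val x} at hmem
      rw [← hmap] at hmem
      obtain ⟨z, hz, hzy⟩ := hmem
      have : z = y := Subtype.ext hzy
      exact hy' (hfix y (this ▸ hz))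
    have hxm : (x : Ω) ∈ IntermediateField.adjoin K {(x : Ω)} :=
      IntermediateField.mem_adjoin_simple_self K _
    have hΩ := (Affine.equation_iff _ _).mp
      ((E.toAffine.baseChange_nonsingular (f := (torsionField E Ω n).val)
        (RingHom.injective _) _ _).mpr h).1
    have hm : ∀ a : K, algebraMap K Ω a ∈ IntermediateField.adjoin K {(x : Ω)} :=
      fun a => IntermediateField.algebraMap_mem _ a
    let M := IntermediateField.adjoin K {(x : Ω)}
    let x₀ : M := ⟨x, hxm⟩
    refine two_dvd_finrank_adjoin_pair hnot
      (b := algebraMap K M E.a₁ * x₀ + algebraMap K M E.a₃)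
      (c := -(x₀ ^ 3 + algebraMap K M E.a₂ * x₀ ^ 2 + algebraMap K M E.a₄ * x₀ +
        algebraMap K M E.a₆)) ?_
    change (y : Ω) ^ 2 + algebraMap K Ω E.a₁ * x * y + algebraMap K Ω E.a₃ * y =
      (x : Ω) ^ 3 + algebraMap K Ω E.a₂ * (x : Ω) ^ 2 + algebraMap K Ω E.a₄ * x +
        algebraMap K Ω E.a₆ at hΩ
    change (y : Ω) ^ 2 + (algebraMap K Ω E.a₁ * x + algebraMap K Ω E.a₃) * y +
      -((x : Ω) ^ 3 + algebraMap K Ω E.a₂ * (x : Ω) ^ 2 + algebraMap K Ω E.a₄ * x +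
        algebraMap K Ω E.a₆) = 0
    linear_combination hΩ

end Galois

end

end EllipticTorsion

open EllipticTorsion in
theorem mainTheorem7 {K : Type*} [Field K] [NumberField K] [DecidableEq (AlgebraicClosure K)]
    (E : WeierstrassCurve K) [E.IsElliptic] (ℓ : ℕ) (hℓ : ℓ.Prime) (hℓ5 : 5 ≤ ℓ)
    (α : (ZMod ℓ)ˣ) (hα : ∀ u : (ZMod ℓ)ˣ, u ∈ Subgroup.zpowers α)
    (hR : ∃ R ∈ torsion E (AlgebraicClosure K) ℓ, R ≠ 0 ∧
      ¬ 2 ∣ Module.finrank K (pointField R)) :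
    ∃ B : Module.Basis (Fin 2) (ZMod ℓ) (torsion E (AlgebraicClosure K) ℓ),
      galImage B ≤ borelSubgroup (ZMod ℓ) ∨
      galImage B ≤ Subgroup.normalizer (splitCartan (ZMod ℓ) : Set (GL (Fin 2) (ZMod ℓ))) ∨
      galImage B ≤
        Subgroup.normalizer (nonsplitCartan (α : ZMod ℓ) : Set (GL (Fin 2) (ZMod ℓ))) := by
  have : Fact ℓ.Prime := ⟨hℓ⟩
  have hℓ2 : ℓ ≠ 2 := by omega
  have : CharZero (AlgebraicClosure K) := charZero_of_injective_algebraMap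
    (algebraMap K (AlgebraicClosure K)).injective
  obtain ⟨B⟩ := exists_basis_torsion E (AlgebraicClosure K) hℓ2
  obtain ⟨R, hRmem, hR0, hR2⟩ := hR
  -- The only use of the odd degree of `K(R)`.
  have hneg : -1 ∉ galImage B := by
    rintro ⟨σ, hσ⟩
    exact hR2 (two_dvd_finrank_pointField (hℓ.odd_of_ne_two hℓ2) (R := ⟨R, hRmem⟩) hR0
      (galAction_eq_neg_of_rho B hσ _))
  obtain ⟨P, hP⟩ := exists_conj_le hℓ2 hneg α hα
  obtain ⟨B', hB'⟩ := exists_basis_rho_conj B P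
  have hle : ∀ {H : Subgroup (GL (Fin 2) (ZMod ℓ))},
      (∀ g ∈ galImage B, P * g * P⁻¹ ∈ H) → galImage B' ≤ H := by
    rintro H h _ ⟨σ, rfl⟩
    rw [hB']
    exact h _ ⟨σ, rfl⟩
  exact ⟨B', hP.imp hle (Or.imp hle hle)⟩
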